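/- Let $k$ be an algebraically closed field, $Q$ a finite quiver with vertex set $Q_0$ and arrow set $Q_1$ (oriented cycles are allowed), $A=kQ$ its path algebra, and $R\subseteq A$ the subalgebra generated by the idempotents $e_i$, $i\in Q_0$. Left $A$-modules are identified with representations of $Q$. Let $T$ be a finite-dimensional left $A$-module, and let $$B=A[T]=\left\{\begin{pmatrix}a&t\\0&\lambda\end{pmatrix} : a\in A,\ t\in T,\ \lambda\in k\right\}$$ be the one-point extension of $A$ by $T$, with subalgebra $\tilde R=\bigoplus_{i\in Q_0} k\begin{pmatrix}e_i&0\\0&0\end{pmatrix}\oplus k\begin{pmatrix}0&0\\0&1\end{pmatrix}$. A finite-dimensional left $B$-module is written as $\tilde M=(M,V,f)$, where $M$ is a finite-dimensional $A$-module, $V$ a finite-dimensional $k$-vector space and $f:T\otimes_k V\to M$ an $A$-linear map; it is $M\oplus V$ with the action $\begin{pmatrix}a&t\\0&\lambda\end{pmatrix}(m,v)=(am+f(t\otimes v),\lambda v)$. It is called full if $f$ is surjective. Let $\tilde M=(M,V,f)$ and $\tilde N=(N,W,g)$ be two such modules. For a $k$-algebra $C$ with a subalgebra $S$ and for $C$-modules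 $X,Y$, let $\mathrm{Der}_S(C,\mathrm{Hom}_k(X,Y))$ be the space of $k$-linear maps $D:C\to \mathrm{Hom}_k(X,Y)$ with $D|_S=0$ and $D(xy)=xD(y)+D(x)y$. Let $\langle X,Y\rangle_C=\sum_{n\ge 0}(-1)^n\dim_k\mathrm{Ext}^n_C(X,Y)$ be the homological Euler form, defined if all these spaces are finite-dimensional and almost all of them vanish. For $d,d'\in\mathbb N^{Q_0}$ let $\langle d,d'\rangle_Q=\sum_{i\in Q_0}d_id'_i-\sum_{(\alpha: i\to j)\in Q_1}d_id'_j$, and let $\underline{\dim}\,X=(\dim_k e_iX)_{i\in Q_0}$ for a finite-dimensional $A$-module $X$. **(1)** The spaces $\mathrm{Der}_{\tilde R}(B,\mathrm{Hom}_k(\tilde N,\tilde M))$, $\mathrm{Der}_R(A,\mathrm{Hom}_k(N,M))$ and $\mathrm{Ext}^1_A(\ker g,M)$ are finite-dimensional, $\langle T,M\rangle_A$ is defined, and $$\dim \mathrm{Der}_{\tilde R}(B,\mathrm{Hom}_k(\tilde N,\tilde M))=\dim \mathrm{Der}_R(A,\mathrm{Hom}_k(N,M))+\dim W\cdot\langle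 T,M\rangle_A+\dim\mathrm{Ext}^1_A(\ker g,M).$$ **(2)** If $\mathrm{Ext}^1_A(T,T)=0$ and $\tilde M$ and $\tilde N$ are full, then $\mathrm{Ext}^1_A(\ker g,M)=0$, and hence $$\dim \mathrm{Der}_{\tilde R}(B,\mathrm{Hom}_k(\tilde N,\tilde M))=\dim \mathrm{Der}_R(A,\mathrm{Hom}_k(N,M))+\dim W\cdot\langle T,M\rangle_A.$$ **(3)** The homological Euler form $\langle\tilde M,\tilde N\rangle_B$ is defined. With $(s,d)=(\dim V,\underline{\dim}\,M)$ and $(s',d')=(\dim W,\underline{\dim}\,N)$, $$\langle\tilde M,\tilde N\rangle_{B}=ss'-s\,\langle\underline{\dim}\,T,d'\rangle_Q+\langle d,d'\rangle_Q.$$ -/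

import Mathlib

universe u

set_option linter.unusedSectionVars false

open CategoryTheory TensorProduct

/-! ### The path algebra of a finite quiver -/

/-- The path algebra `kQ`: the vector space with basis the paths of `Q`. The product `p * q` of two
paths is the path "first `q`, then `p`" if `q` ends where `p` starts, and `0` otherwise, so that
left modules over `kQ` are covariant representations of `Q`. -/
def PathAlgebra (k Q : Type u) [Field k] [Quiver.{u} Q] : Type u :=
  (Σ i : Q, Σ j : Q, Quiver.Path i j) →₀ k

namespace PathAlgebra

noncomputable section

section Basic

variable {k Q : Type u} [Field k] [Quiver.{u} Q]

instance : AddCommGroup (PathAlgebra k Q) :=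
  inferInstanceAs (AddCommGroup ((Σ i : Q, Σ j : Q, Quiver.Path i j) →₀ k))

instance : Module k (PathAlgebra k Q) :=
  inferInstanceAs (Module k ((Σ i : Q, Σ j : Q, Quiver.Path i j) →₀ k))

variable (k Q) in
/-- The basis of `kQ` that consists of the paths of `Q`. -/
def basis : Module.Basis (Σ i : Q, Σ j : Q, Quiver.Path i j) k (PathAlgebra k Q) :=
  Module.Basis.ofRepr (LinearEquiv.refl k ((Σ i : Q, Σ j : Q, Quiver.Path i j) →₀ k))

variable (k) in
/-- The basis element of `kQ` given by a path `p : i ⟶ … ⟶ j`. -/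
def ofPath {i j : Q} (p : Quiver.Path i j) : PathAlgebra k Q := basis k Q ⟨i, j, p⟩

variable (k) in
/-- The idempotent `e i` given by the path of length `0` at `i`. -/
def e (i : Q) : PathAlgebra k Q := ofPath k (Quiver.Path.nil : Quiver.Path i i)

open Classical in
variable (k) in
/-- The product of two paths. -/
def pathMul {i j i' j' : Q} (p : Quiver.Path i j) (q : Quiver.Path i' j') : PathAlgebra k Q :=
  if h : j' = i then ofPath k (q.comp (p.cast h.symm rfl)) else 0

variable (k Q) in
/-- The multiplication of `kQ`, the bilinear extension of the product of paths. -/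
def mulHom : PathAlgebra k Q →ₗ[k] PathAlgebra k Q →ₗ[k] PathAlgebra k Q :=
  (basis k Q).constr k fun p => (basis k Q).constr k fun q => pathMul k p.2.2 q.2.2

instance : Mul (PathAlgebra k Q) := ⟨fun x y => mulHom k Q x y⟩

theorem mul_def (x y : PathAlgebra k Q) : x * y = mulHom k Q x y := rfl

theorem ofPath_mul_ofPath {i j i' j' : Q} (p : Quiver.Path i j) (q : Quiver.Path i' j') :
    ofPath k p * ofPath k q = pathMul k p q := by
  simp [mul_def, mulHom, ofPath]

theorem ofPath_mul_comp {i j l : Q} (p : Quiver.Path j l) (q : Quiver.Path i j) :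
    ofPath k p * ofPath k q = ofPath k (q.comp p) := by
  simp [ofPath_mul_ofPath, pathMul]

theorem ofPath_mul_of_ne {i j i' j' : Q} (p : Quiver.Path i j) (q : Quiver.Path i' j')
    (h : j' ≠ i) : ofPath k p * ofPath k q = 0 := by
  simp [ofPath_mul_ofPath, pathMul, h]

theorem induction {P : PathAlgebra k Q → Prop} (x : PathAlgebra k Q) (h0 : P 0)
    (hadd : ∀ x y, P x → P y → P (x + y))
    (hs : ∀ (c : k) (i j : Q) (p : Quiver.Path i j), P (c • ofPath k p)) : P x := by
  rw [← (basis k Q).repr.symm_apply_apply x]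
  induction (basis k Q).repr x using Finsupp.induction_linear with
  | zero => simpa using h0
  | add f g hf hg => simpa using hadd _ _ hf hg
  | single p c => simpa [ofPath] using hs c p.1 p.2.1 p.2.2

theorem assoc_aux (x y z : PathAlgebra k Q) : x * y * z = x * (y * z) := by
  simp only [mul_def]
  induction x using induction with
  | h0 => simp
  | hadd x x' h h' => simp [h, h']
  | hs c i j p =>
    simp only [map_smul, LinearMap.smul_apply]
    congr 1
    induction y using induction with
    | h0 => simp
    | hadd x x' h h' => simp [h, h']
    | hs c i' j' q =>
      simp only [map_smul, LinearMap.smul_apply]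
      congr 1
      induction z using induction with
      | h0 => simp
      | hadd x x' h h' => simp [h, h']
      | hs c i'' j'' r =>
        simp only [map_smul]
        congr 1
        simp only [← mul_def]
        by_cases h : j' = i
        · subst h
          by_cases h' : j'' = i'
          · subst h'
            simp [ofPath_mul_comp, Quiver.Path.comp_assoc]
          · rw [ofPath_mul_comp, ofPath_mul_of_ne _ _ h', ofPath_mul_of_ne _ _ h']
            simp [mul_def]
        · rw [ofPath_mul_of_ne _ _ h]
          by_cases h' : j'' = i'
          · subst h'
            rw [ofPath_mul_comp, ofPath_mul_of_ne _ _ h]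
            simp [mul_def]
          · rw [ofPath_mul_of_ne _ _ h']
            simp [mul_def]

end Basic

variable {k Q : Type u} [Field k] [Quiver.{u} Q] [Fintype Q]

instance : One (PathAlgebra k Q) := ⟨∑ i : Q, e k i⟩

theorem one_def : (1 : PathAlgebra k Q) = ∑ i : Q, e k i := rfl

theorem one_mul_aux (x : PathAlgebra k Q) : 1 * x = x := by
  induction x using induction with
  | h0 => simp [mul_def]
  | hadd x y h h' => rw [mul_def] at *; simp [h, h']
  | hs c i j p =>
    rw [mul_def, map_smul]
    congr 1
    rw [one_def, map_sum, LinearMap.sum_apply, Finset.sum_eq_single j]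
    · rw [← mul_def, e, ofPath_mul_comp]; rfl
    · intro b _ hb
      rw [← mul_def, e, ofPath_mul_of_ne _ _ hb.symm]
    · simp

theorem mul_one_aux (x : PathAlgebra k Q) : x * 1 = x := by
  induction x using induction with
  | h0 => simp [mul_def]
  | hadd x y h h' => rw [mul_def] at *; simp [h, h']
  | hs c i j p =>
    rw [mul_def, map_smul, LinearMap.smul_apply]
    congr 1
    rw [one_def, map_sum, Finset.sum_eq_single i]
    · rw [← mul_def, e, ofPath_mul_comp, Quiver.Path.nil_comp]
    · intro b _ hb
      rw [← mul_def, e, ofPath_mul_of_ne _ _ hb]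
    · simp

instance : Ring (PathAlgebra k Q) where
  __ := (inferInstance : AddCommGroup (PathAlgebra k Q))
  mul_assoc := assoc_aux
  one_mul := one_mul_aux
  mul_one := mul_one_aux
  left_distrib x y z := by simp [mul_def]
  right_distrib x y z := by simp [mul_def]
  zero_mul x := by simp [mul_def]
  mul_zero x := by simp [mul_def]

instance : Algebra k (PathAlgebra k Q) :=
  Algebra.ofModule (fun c x y => by simp [mul_def]) (fun c x y => by simp [mul_def])

variable (k Q) in
/-- The semisimple subalgebra `R` of `kQ` generated by the vertices. -/
def vertexSubalgebra : Subalgebra k (PathAlgebra k Q) :=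
  Algebra.adjoin k (Set.range (e k))

variable (k) in
/-- The dimension vector `i ↦ dim (e i • M)` of a module over `kQ`. -/
def dimVec (M : Type u) [AddCommGroup M] [Module k M] [Module (PathAlgebra k Q) M]
    [IsScalarTower k (PathAlgebra k Q) M] (i : Q) : ℕ :=
  Module.finrank k (LinearMap.range (Algebra.lsmul k k M (e k i)))

end

end PathAlgebra

/-- The Euler form `⟨d, d'⟩_Q = ∑ i, d i * d' i - ∑ (α : i ⟶ j), d i * d' j` of a finite quiver. -/
def quiverEulerForm (Q : Type u) [Quiver.{u} Q] [Fintype Q] [∀ i j : Q, Fintype (i ⟶ j)]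
    (d d' : Q → ℕ) : ℤ :=
  ∑ i, (d i : ℤ) * d' i - ∑ i, ∑ j, ∑ _α : i ⟶ j, (d i : ℤ) * d' j

/-! ### One-point extensions and their modules -/

/-- The one-point extension `A[T]`: the matrices with rows `(a, t)` and `(0, c)`, where `a ∈ A`,
`t ∈ T` and `c ∈ k`. -/
@[ext]
structure OnePointExt (k A T : Type u) : Type u where
  /-- the upper left entry -/
  a : A
  /-- the upper right entry -/
  t : T
  /-- the lower right entry -/
  c : k

namespace OnePointExt

section

variable {k A T : Type u} [Field k] [Ring A] [Algebra k A] [AddCommGroup T] [Module k T]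
  [Module A T] [IsScalarTower k A T]

instance : Zero (OnePointExt k A T) := ⟨⟨0, 0, 0⟩⟩
instance : One (OnePointExt k A T) := ⟨⟨1, 0, 1⟩⟩
instance : Add (OnePointExt k A T) := ⟨fun x y => ⟨x.a + y.a, x.t + y.t, x.c + y.c⟩⟩
instance : Neg (OnePointExt k A T) := ⟨fun x => ⟨-x.a, -x.t, -x.c⟩⟩
instance : Mul (OnePointExt k A T) :=
  ⟨fun x y => ⟨x.a * y.a, x.a • y.t + y.c • x.t, x.c * y.c⟩⟩
instance : SMul k (OnePointExt k A T) := ⟨fun r x => ⟨r • x.a, r • x.t, r • x.c⟩⟩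

@[simp] theorem zero_a : (0 : OnePointExt k A T).a = 0 := rfl
@[simp] theorem zero_t : (0 : OnePointExt k A T).t = 0 := rfl
@[simp] theorem zero_c : (0 : OnePointExt k A T).c = 0 := rfl
@[simp] theorem one_a : (1 : OnePointExt k A T).a = 1 := rfl
@[simp] theorem one_t : (1 : OnePointExt k A T).t = 0 := rfl
@[simp] theorem one_c : (1 : OnePointExt k A T).c = 1 := rfl
@[simp] theorem add_a (x y : OnePointExt k A T) : (x + y).a = x.a + y.a := rfl
@[simp] theorem add_t (x y : OnePointExt k A T) : (x + y).t = x.t + y.t := rfl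
@[simp] theorem add_c (x y : OnePointExt k A T) : (x + y).c = x.c + y.c := rfl
@[simp] theorem neg_a (x : OnePointExt k A T) : (-x).a = -x.a := rfl
@[simp] theorem neg_t (x : OnePointExt k A T) : (-x).t = -x.t := rfl
@[simp] theorem neg_c (x : OnePointExt k A T) : (-x).c = -x.c := rfl
@[simp] theorem mul_a (x y : OnePointExt k A T) : (x * y).a = x.a * y.a := rfl
@[simp] theorem mul_t (x y : OnePointExt k A T) : (x * y).t = x.a • y.t + y.c • x.t := rfl
@[simp] theorem mul_c (x y : OnePointExt k A T) : (x * y).c = x.c * y.c := rfl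
@[simp] theorem smul_a (r : k) (x : OnePointExt k A T) : (r • x).a = r • x.a := rfl
@[simp] theorem smul_t (r : k) (x : OnePointExt k A T) : (r • x).t = r • x.t := rfl
@[simp] theorem smul_c (r : k) (x : OnePointExt k A T) : (r • x).c = r • x.c := rfl

instance : Ring (OnePointExt k A T) where
  add_assoc x y z := by ext <;> simp [add_assoc]
  zero_add x := by ext <;> simp
  add_zero x := by ext <;> simp
  add_comm x y := by ext <;> simp [add_comm]
  neg_add_cancel x := by ext <;> simp
  nsmul := nsmulRec
  zsmul := zsmulRec
  left_distrib x y z := by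
    ext
    · simp [mul_add]
    · simp only [mul_t, add_t, add_c, smul_add, add_smul]; abel
    · simp [mul_add]
  right_distrib x y z := by
    ext
    · simp [add_mul]
    · simp only [mul_t, add_t, add_a, smul_add, add_smul]; abel
    · simp [add_mul]
  zero_mul x := by ext <;> simp
  mul_zero x := by ext <;> simp
  mul_assoc x y z := by
    ext
    · simp [mul_assoc]
    · simp only [mul_t, mul_a, mul_c, smul_add, mul_smul, smul_comm z.c y.c,
        smul_comm z.c x.a, add_assoc]
    · simp [mul_assoc]
  one_mul x := by ext <;> simp
  mul_one x := by ext <;> simp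

instance : Module k (OnePointExt k A T) where
  one_smul x := by ext <;> simp
  mul_smul r s x := by ext <;> simp [mul_smul, mul_assoc]
  smul_zero r := by ext <;> simp
  smul_add r x y := by ext <;> simp [mul_add]
  add_smul r s x := by ext <;> simp [add_smul, add_mul]
  zero_smul x := by ext <;> simp

instance : Algebra k (OnePointExt k A T) :=
  Algebra.ofModule
    (fun r x y => by
      ext
      · simp
      · simp only [mul_t, smul_t, smul_a, smul_add, smul_assoc, smul_comm r y.c]
      · simp [mul_assoc])
    (fun r x y => by
      ext
      · simp
      · simp only [mul_t, smul_t, smul_c, smul_add, smul_assoc, smul_comm x.a r]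
      · simp [mul_left_comm])

end

/-- The subalgebra `R̃` of `A[T]`, where `A = kQ`, spanned by the idempotents that belong to the
vertices of `Q` and to the extension vertex. -/
noncomputable def vertexSubalgebra (k Q T : Type u) [Field k] [Quiver.{u} Q] [Fintype Q] [AddCommGroup T]
    [Module k T] [Module (PathAlgebra k Q) T] [IsScalarTower k (PathAlgebra k Q) T] :
    Subalgebra k (OnePointExt k (PathAlgebra k Q) T) :=
  Algebra.adjoin k (Set.range (fun i : Q => ⟨PathAlgebra.e k i, 0, 0⟩) ∪ {⟨0, 0, 1⟩})

variable {k A T M V : Type u} [Field k] [Ring A] [Algebra k A] [AddCommGroup T] [Module k T]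
  [Module A T] [IsScalarTower k A T] [AddCommGroup M] [Module k M] [Module A M]
  [IsScalarTower k A M] [AddCommGroup V] [Module k V]

/-- The left `A[T]`-module `(M, V, f : T ⊗ V → M)`: its elements are the columns `(m, v)`, and
`A[T]` acts by `(a, t; 0, c) • (m, v) = (a m + f (t ⊗ v), c v)`. -/
@[nolint unusedArguments]
def Mod (_f : T ⊗[k] V →ₗ[A] M) : Type u := M × V

namespace Mod

variable (f : T ⊗[k] V →ₗ[A] M)

instance : AddCommGroup (Mod f) := inferInstanceAs (AddCommGroup (M × V))
instance : Module k (Mod f) := inferInstanceAs (Module k (M × V))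

variable {f}

/-- The element `(m, v)`. -/
def mk (m : M) (v : V) : Mod f := (m, v)

/-- The first component. -/
def fst (x : Mod f) : M := Prod.fst x

/-- The second component. -/
def snd (x : Mod f) : V := Prod.snd x

@[ext] theorem ext {x y : Mod f} (h : x.fst = y.fst) (h' : x.snd = y.snd) : x = y := Prod.ext h h'

instance : SMul (OnePointExt k A T) (Mod f) :=
  ⟨fun b x => mk (b.a • x.fst + f (b.t ⊗ₜ x.snd)) (b.c • x.snd)⟩

@[simp] theorem fst_zero : (0 : Mod f).fst = 0 := rfl
@[simp] theorem snd_zero : (0 : Mod f).snd = 0 := rfl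
@[simp] theorem fst_add (x y : Mod f) : (x + y).fst = x.fst + y.fst := rfl
@[simp] theorem snd_add (x y : Mod f) : (x + y).snd = x.snd + y.snd := rfl
@[simp] theorem fst_smul (r : k) (x : Mod f) : (r • x).fst = r • x.fst := rfl
@[simp] theorem snd_smul (r : k) (x : Mod f) : (r • x).snd = r • x.snd := rfl
@[simp] theorem fst_act (b : OnePointExt k A T) (x : Mod f) :
    (b • x).fst = b.a • x.fst + f (b.t ⊗ₜ x.snd) := rfl
@[simp] theorem snd_act (b : OnePointExt k A T) (x : Mod f) : (b • x).snd = b.c • x.snd := rfl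

instance : Module (OnePointExt k A T) (Mod f) where
  one_smul x := by ext <;> simp
  mul_smul b b' x := by
    ext
    · simp only [fst_act, mul_a, mul_t, snd_act, add_tmul, map_add, smul_add, mul_smul, add_assoc]
      rw [← map_smul f b.a, TensorProduct.smul_tmul', TensorProduct.smul_tmul b'.c]
    · simp [mul_smul]
  smul_zero b := by ext <;> simp
  smul_add b x y := by
    ext
    · simp only [fst_act, fst_add, snd_add, smul_add, tmul_add, map_add]; abel
    · simp
  add_smul b b' x := by
    ext
    · simp only [fst_act, fst_add, add_a, add_t, add_smul, add_tmul, map_add]; abel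
    · simp [add_smul]
  zero_smul x := by ext <;> simp

instance : IsScalarTower k (OnePointExt k A T) (Mod f) where
  smul_assoc r b x := by
    ext
    · simp only [fst_act, smul_a, smul_t, fst_smul, smul_add, smul_assoc]
      rw [← TensorProduct.smul_tmul', ← algebraMap_smul A r (b.t ⊗ₜ[k] x.snd), map_smul,
        algebraMap_smul]
    · simp [mul_smul]

end Mod

end OnePointExt

/-! ### Derivations, extensions and Euler forms -/

/-- The space `Der_S(B, Hom_k(N, M))` of `S`-derivations of a `k`-algebra `B` with values in the
`B`-bimodule `Hom_k(N, M)`: the `k`-linear maps `D` which vanish on `S` and satisfy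
`D (x y) = x D(y) + D(x) y`, where `(x φ y)(n) = x • φ (y • n)`. -/
def relDer {k B : Type u} [Field k] [Ring B] [Algebra k B] (S : Subalgebra k B)
    (N M : Type u) [AddCommGroup N] [Module k N] [Module B N] [IsScalarTower k B N]
    [AddCommGroup M] [Module k M] [Module B M] [IsScalarTower k B M] :
    Submodule k (B →ₗ[k] N →ₗ[k] M) where
  carrier := {D | (∀ r ∈ S, D r = 0) ∧
    ∀ (x y : B) (n : N), D (x * y) n = x • D y n + D x (y • n)}
  zero_mem' := by simp
  add_mem' := by
    rintro D D' ⟨h, h'⟩ ⟨l, l'⟩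
    refine ⟨fun r hr => by simp [h r hr, l r hr], fun x y n => ?_⟩
    simp only [LinearMap.add_apply, h', l', smul_add]
    abel
  smul_mem' := by
    rintro c D ⟨h, h'⟩
    refine ⟨fun r hr => by simp [h r hr], fun x y n => ?_⟩
    simp only [LinearMap.smul_apply, h', smul_add, smul_comm x c]

/-- The group `Ext^n_B(N, M)` of two modules over a ring `B`. It is a vector space over `k`
whenever `B` is a `k`-algebra. -/
abbrev ExtMod (B : Type u) [Ring B] (N M : Type u) [AddCommGroup N] [Module B N]
    [AddCommGroup M] [Module B M] (n : ℕ) : Type u :=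
  Abelian.Ext.{u} (ModuleCat.of B N) (ModuleCat.of B M) n

/-- The spaces `Ext^n_B(N, M)` are finite-dimensional over `k` and almost all of them vanish, so
that the alternating sum of their dimensions makes sense. -/
def HasEulerForm (k B : Type u) [Field k] [Ring B] [Algebra k B] (N M : Type u)
    [AddCommGroup N] [Module B N] [AddCommGroup M] [Module B M] : Prop :=
  (∀ n, Module.Finite k (ExtMod B N M n)) ∧ ∃ n₀, ∀ n > n₀, Subsingleton (ExtMod B N M n)

/-- The homological Euler form `⟨N, M⟩_B = ∑ n, (-1)^n dim Ext^n_B(N, M)`. -/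
noncomputable def homEulerForm (k B : Type u) [Field k] [Ring B] [Algebra k B] (N M : Type u)
    [AddCommGroup N] [Module B N] [AddCommGroup M] [Module B M] : ℤ :=
  ∑ᶠ n : ℕ, (-1) ^ n * (Module.finrank k (ExtMod B N M n) : ℤ)

/-! Everything is read off from derivations. For an algebra C and a C-module X, let K be the kernel
of the action map C ⊗ X → X. Then Hom_C(K, Y) = Der_k(C, Hom_k(X, Y)) and Hom_C(C ⊗ X, Y) = Hom_k(X,
Y) (`actionKerHomEquiv`, `tensorHomEquiv`). If derivations lift along surjections Y → Z, then K is
projective and 0 → K → C ⊗ X → X → 0 is a projective resolution. Hence ⟨X, Y⟩_C = dim Hom_k(X, Y) -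
dim Der_k(C, Hom_k(X, Y)), and dim Ext¹(X, Y) is the dimension of derivations modulo inner ones
(`DerivationsLift.eulerForm`, `DerivationsLift.finrank_quotient_range_innerDer`).

For C = kQ every derivation is an inner one plus one that vanishes on R, and the latter amounts to a
free choice of linear maps e_i X → e_j Y, one for each arrow i → j. So derivations lift along
surjections and extend along injections (`derivationsLift`, `exists_fullDer_extension`), and
counting dimensions identifies the homological Euler form with that of the quiver
(`homEulerForm_eq`).

For (1), a derivation of A[T] that vanishes on R̃ is a pair of D in Der_R(A, Hom_k(N, M)) and a
linear map h : T ⊗ W → M with h(a x) = a h(x) + D(a) g(x). Such pairs form the kernel of Der_R(A,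
Hom_k(N, M)) × Hom_k(T ⊗ W, M) → Der_k(A, Hom_k(T ⊗ W, M)), (D, h) ↦ D ∘ g + inner(h), whose
cokernel is the space of derivations into Hom_k(ker g, M) modulo inner ones (`derEquiv`,
`ker_restrictKer`, `restrictKer_surjective`). The two middle terms involving T ⊗ W contribute ⟨T ⊗
W, M⟩ = dim W · ⟨T, M⟩.

For (2), the condition that all derivations are inner passes from (T, T) to (T, T ⊗ V), to the
quotient M of T ⊗ V, to (T ⊗ W, M), and finally to the submodule ker g of T ⊗ W.

For (3), use 0 → (T ⊗ V, 0, 0) → (M, 0, 0) × (T ⊗ V, V, id) → (M, V, f) → 0. The module (T ⊗ V, V,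
id) is projective with Hom into (N, W, g) equal to Hom_k(V, W), while resolutions over A carry over
to the modules (X, 0, 0), so that ⟨(X, 0, 0), (N, W, g)⟩ = ⟨X, N⟩_A. -/

/-! ### Euler characteristics along long exact sequences -/

section LongExact

variable {k : Type u} [Field k]

/-- The alternating sum of the dimensions of a sequence of finite-dimensional spaces that
eventually vanish is a finite sum. -/
theorem finsum_alternating_eq_sum (a : ℕ → ℕ) (n₀ : ℕ) (h : ∀ n ≥ n₀, a n = 0) :
    ∑ᶠ n : ℕ, (-1) ^ n * (a n : ℤ) = ∑ n ∈ Finset.range n₀, (-1) ^ n * (a n : ℤ) := by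
  apply finsum_eq_sum_of_support_subset
  intro n hn
  by_contra hc
  simp only [Finset.coe_range, Set.mem_Iio, not_lt] at hc
  exact hn (by simp [h n hc])

theorem sum_alternating_telescope (r : ℕ → ℤ) (h0 : r 0 = 0) (n : ℕ) :
    ∑ i ∈ Finset.range n, (-1) ^ i * (r i + r (i + 1)) = - (-1) ^ n * r n := by
  induction n with
  | zero => simp [h0]
  | succ n ih => rw [Finset.sum_range_succ, ih, pow_succ]; ring

/-- Additivity of Euler characteristics along a long exact sequence
`0 → X₃⁰ → X₂⁰ → X₁⁰ → X₃¹ → …`. -/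
theorem euler_char_of_long_exact {X₁ X₂ X₃ : ℕ → Type u}
    [∀ n, AddCommGroup (X₁ n)] [∀ n, Module k (X₁ n)] [∀ n, AddCommGroup (X₂ n)]
    [∀ n, Module k (X₂ n)] [∀ n, AddCommGroup (X₃ n)] [∀ n, Module k (X₃ n)]
    (g : ∀ n, X₃ n →ₗ[k] X₂ n) (f : ∀ n, X₂ n →ₗ[k] X₁ n) (d : ∀ n, X₁ n →ₗ[k] X₃ (n + 1))
    (h0 : Function.Injective (g 0)) (hgf : ∀ n, Function.Exact (g n) (f n))
    (hfd : ∀ n, Function.Exact (f n) (d n)) (hdg : ∀ n, Function.Exact (d n) (g (n + 1)))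
    (fin₁ : ∀ n, Module.Finite k (X₁ n)) (fin₂ : ∀ n, Module.Finite k (X₂ n))
    {n₁ n₂ : ℕ} (hn₁ : ∀ n > n₁, Subsingleton (X₁ n)) (hn₂ : ∀ n > n₂, Subsingleton (X₂ n)) :
    (∀ n, Module.Finite k (X₃ n)) ∧ (∃ n₀, ∀ n > n₀, Subsingleton (X₃ n)) ∧
    ∑ᶠ n : ℕ, (-1) ^ n * (Module.finrank k (X₃ n) : ℤ) =
      ∑ᶠ n : ℕ, (-1) ^ n * (Module.finrank k (X₂ n) : ℤ) -
      ∑ᶠ n : ℕ, (-1) ^ n * (Module.finrank k (X₁ n) : ℤ) := by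
  have fker : ∀ n, Module.Finite k (LinearMap.ker (g n)) := by
    rintro (_ | n)
    · rw [LinearMap.ker_eq_bot.2 h0]; infer_instance
    · rw [(hdg n).linearMap_ker_eq]; infer_instance
  have fin₃ : ∀ n, Module.Finite k (X₃ n) := fun n => by
    have := fker n
    have : Module.Finite k (X₃ n ⧸ LinearMap.ker (g n)) :=
      Module.Finite.equiv (g n).quotKerEquivRange.symm
    exact Module.Finite.of_submodule_quotient (LinearMap.ker (g n))
  -- `X₃ (n + 1)` sits between `X₁ n` and `X₂ (n + 1)`; the shift by one in `X₁` accounts for the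
  -- bound.
  have van : ∀ n > max n₁ n₂ + 1, Subsingleton (X₃ n) := by
    rintro (_ | n) hn
    · omega
    · have h₁ := hn₁ n (by omega)
      have h₂ := hn₂ (n + 1) (by omega)
      refine subsingleton_of_forall_eq 0 fun x => ?_
      obtain ⟨y, rfl⟩ := (hdg n x).1 (Subsingleton.elim _ _)
      rw [Subsingleton.elim y 0, map_zero]
  refine ⟨fin₃, ⟨_, van⟩, ?_⟩
  set N := max n₁ n₂ + 2 with hN
  rw [finsum_alternating_eq_sum _ N, finsum_alternating_eq_sum _ N,
    finsum_alternating_eq_sum _ N, ← Finset.sum_sub_distrib, ← sub_eq_zero,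
    ← Finset.sum_sub_distrib]
  rotate_left
  · intro n hn
    have := hn₁ n (by omega)
    exact Module.finrank_zero_of_subsingleton
  · intro n hn
    have := hn₂ n (by omega)
    exact Module.finrank_zero_of_subsingleton
  · intro n hn
    have := van n (by omega)
    exact Module.finrank_zero_of_subsingleton
  -- By exactness, dim X₃ - dim X₂ + dim X₁ in degree `n` equals `r n + r (n + 1)`, so the
  -- alternating sum telescopes to a boundary term, which vanishes because `r 0 = r N = 0`.
  let r : ℕ → ℤ := fun n => Module.finrank k (LinearMap.ker (g n))
  have hr0 : r 0 = 0 := by simp [r, LinearMap.ker_eq_bot.2 h0]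
  have key := sum_alternating_telescope r hr0 N
  have hrN : r N = 0 := by
    have := van N (by omega)
    simp [r, Module.finrank_zero_of_subsingleton]
  rw [hrN, mul_zero] at key
  rw [← key]
  refine Finset.sum_congr rfl fun n _ => ?_
  have e₃ := (g n).finrank_range_add_finrank_ker
  have e₂ := (f n).finrank_range_add_finrank_ker
  have e₁ := (d n).finrank_range_add_finrank_ker
  rw [(hgf n).linearMap_ker_eq] at e₂
  rw [(hfd n).linearMap_ker_eq, ← (hdg n).linearMap_ker_eq] at e₁
  simp only [r]
  rw [← e₁, ← e₂, ← e₃]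
  push_cast
  ring

end LongExact

/-! ### Euler forms from short exact sequences and short projective resolutions -/

section ExtEuler

open Abelian ModuleCat

variable {k C : Type u} [Field k] [Ring C] [Algebra k C]
  {X X₁ X₂ X₃ Y : Type u} [AddCommGroup X] [Module C X]
  [AddCommGroup X₁] [Module C X₁] [AddCommGroup X₂] [Module C X₂]
  [AddCommGroup X₃] [Module C X₃] [AddCommGroup Y] [Module C Y]

theorem shortExact_moduleCat {i : X₁ →ₗ[C] X₂} {p : X₂ →ₗ[C] X₃} (hi : Function.Injective i)
    (hip : Function.Exact i p) (hp : Function.Surjective p) :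
    (ShortComplex.mk (ModuleCat.ofHom i) (ModuleCat.ofHom p)
      (by ext x; exact hip.apply_apply_eq_zero x)).ShortExact :=
  ModuleCat.shortComplex_shortExact _ hip hi hp

variable (Y) in
/-- Additivity of the homological Euler form in the first variable. -/
theorem eulerForm_of_shortExact {i : X₁ →ₗ[C] X₂} {p : X₂ →ₗ[C] X₃} (hi : Function.Injective i)
    (hip : Function.Exact i p) (hp : Function.Surjective p) (h₁ : HasEulerForm k C X₁ Y)
    (h₂ : HasEulerForm k C X₂ Y) :
    HasEulerForm k C X₃ Y ∧
      homEulerForm k C X₃ Y = homEulerForm k C X₂ Y - homEulerForm k C X₁ Y := by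
  have hS := shortExact_moduleCat hi hip hp
  obtain ⟨fin₁, n₁, hn₁⟩ := h₁
  obtain ⟨fin₂, n₂, hn₂⟩ := h₂
  have := euler_char_of_long_exact (k := k) (X₁ := ExtMod C X₁ Y) (X₂ := ExtMod C X₂ Y)
    (X₃ := ExtMod C X₃ Y)
    (fun n => (Ext.mk₀ (ModuleCat.ofHom p)).precompOfLinear k (ModuleCat.of C Y) (zero_add n))
    (fun n => (Ext.mk₀ (ModuleCat.ofHom i)).precompOfLinear k (ModuleCat.of C Y) (zero_add n))
    (fun n => hS.extClass.precompOfLinear k (ModuleCat.of C Y) (add_comm 1 n))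
    (by
      have : Epi (ModuleCat.ofHom p) := hS.epi_g
      exact Ext.precomp_mk₀_injective_of_epi (ModuleCat.of C Y) (ModuleCat.ofHom p))
    (fun n => (ShortComplex.ab_exact_iff_function_exact _).1
      (Ext.contravariant_sequence_exact₂' hS (ModuleCat.of C Y) n))
    (fun n => (ShortComplex.ab_exact_iff_function_exact _).1
      (Ext.contravariant_sequence_exact₁' hS (ModuleCat.of C Y) n (n + 1) (add_comm 1 n)))
    (fun n => (ShortComplex.ab_exact_iff_function_exact _).1
      (Ext.contravariant_sequence_exact₃' hS (ModuleCat.of C Y) n (n + 1) (add_comm 1 n)))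
    fin₁ fin₂ hn₁ hn₂
  exact ⟨⟨this.1, this.2.1⟩, this.2.2⟩

variable (Y) in
-- Dimension shifting: the connecting map from degree `n` of `X₁` hits everything that dies in `X₂`.
-- It gives the vanishing of `Ext` from degree two on for modules with a projective resolution of
-- length one.
theorem subsingleton_ext_of_shortExact {i : X₁ →ₗ[C] X₂} {p : X₂ →ₗ[C] X₃}
    (hi : Function.Injective i) (hip : Function.Exact i p) (hp : Function.Surjective p) (n : ℕ)
    (h₁ : Subsingleton (ExtMod C X₁ Y n)) (h₂ : Subsingleton (ExtMod C X₂ Y (n + 1))) :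
    Subsingleton (ExtMod C X₃ Y (n + 1)) := by
  have hS := shortExact_moduleCat hi hip hp
  refine subsingleton_of_forall_eq 0 fun x => ?_
  obtain ⟨y, rfl⟩ := Ext.contravariant_sequence_exact₃ hS (ModuleCat.of C Y) x
    (@Subsingleton.elim _ h₂ _ _) (add_comm 1 n)
  rw [@Subsingleton.elim _ h₁ y 0, Ext.comp_zero]

theorem subsingleton_ext_of_projective [Module.Projective C X] (n : ℕ) :
    Subsingleton (ExtMod C X Y (n + 1)) := by
  have : Projective (ModuleCat.of C X) := (IsProjective.iff_projective X).1 inferInstance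
  exact Ext.subsingleton_of_projective (P := ModuleCat.of C X) (Y := ModuleCat.of C Y) (n := n)

variable (k C X Y) in
/-- `Ext⁰` is the space of linear maps. -/
noncomputable def extZeroEquiv [Module k Y] [IsScalarTower k C Y] :
    ExtMod C X Y 0 ≃ₗ[k] (X →ₗ[C] Y) :=
  { toFun x := (Ext.addEquiv₀ x).hom
    invFun φ := Ext.mk₀ (ModuleCat.ofHom φ)
    left_inv x := Ext.addEquiv₀.left_inv x
    right_inv φ := congrArg ModuleCat.Hom.hom (Ext.addEquiv₀.right_inv (ModuleCat.ofHom φ))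
    map_add' x y := by rw [map_add]; rfl
    map_smul' c x := by
      ext y
      exact (congrArg (fun φ => φ.hom y) ((Ext.linearEquiv₀ (R := k)).map_smul c x)).trans
        (algebraMap_smul C c ((Ext.addEquiv₀ x).hom y)) }

theorem eulerForm_of_projective [Module k Y] [IsScalarTower k C Y] [Module.Projective C X]
    [Module.Finite k (X →ₗ[C] Y)] :
    HasEulerForm k C X Y ∧ homEulerForm k C X Y = Module.finrank k (X →ₗ[C] Y) := by
  have van : ∀ n ≥ 1, Subsingleton (ExtMod C X Y n) := by
    rintro (_ | n) hn
    · omega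
    · exact subsingleton_ext_of_projective n
  refine ⟨⟨?_, 0, fun n hn => van n hn⟩, ?_⟩
  · rintro (_ | n)
    · exact Module.Finite.equiv (extZeroEquiv k C X Y).symm
    · have := van (n + 1) (by omega)
      infer_instance
  · rw [homEulerForm, finsum_alternating_eq_sum _ 1]
    · simp [(extZeroEquiv k C X Y).finrank_eq]
    · intro n hn
      have := van n hn
      exact Module.finrank_zero_of_subsingleton

/-- The Euler form of a module of projective dimension at most one. -/
theorem eulerForm_of_resolution [Module k Y] [IsScalarTower k C Y] [Module.Projective C X₁]
    [Module.Projective C X₂] {i : X₁ →ₗ[C] X₂} {p : X₂ →ₗ[C] X₃} (hi : Function.Injective i)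
    (hip : Function.Exact i p) (hp : Function.Surjective p) [Module.Finite k (X₁ →ₗ[C] Y)]
    [Module.Finite k (X₂ →ₗ[C] Y)] :
    HasEulerForm k C X₃ Y ∧ homEulerForm k C X₃ Y =
      Module.finrank k (X₂ →ₗ[C] Y) - Module.finrank k (X₁ →ₗ[C] Y) ∧
      homEulerForm k C X₃ Y =
        Module.finrank k (X₃ →ₗ[C] Y) - Module.finrank k (ExtMod C X₃ Y 1) := by
  have e₁ := eulerForm_of_projective (k := k) (C := C) (X := X₁) (Y := Y)
  have e₂ := eulerForm_of_projective (k := k) (C := C) (X := X₂) (Y := Y)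
  have e₃ := eulerForm_of_shortExact Y hi hip hp e₁.1 e₂.1
  refine ⟨e₃.1, by rw [e₃.2, e₁.2, e₂.2], ?_⟩
  rw [homEulerForm, finsum_alternating_eq_sum _ 2]
  · simp [Finset.sum_range_succ, (extZeroEquiv k C X₃ Y).finrank_eq, sub_eq_add_neg]
  · rintro (_ | _ | n) hn
    · omega
    · omega
    · have := subsingleton_ext_of_shortExact Y hi hip hp (n + 1)
        (subsingleton_ext_of_projective n) (subsingleton_ext_of_projective _)
      exact Module.finrank_zero_of_subsingleton

end ExtEuler

section

set_option maxSynthPendingDepth 3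

/-! ### Derivations and the kernel of the action map -/

noncomputable section DerivationResolution

variable {k C : Type u} [Field k] [Ring C] [Algebra k C]
  {X X' Y Z : Type u} [AddCommGroup X] [Module k X] [Module C X] [IsScalarTower k C X]
  [AddCommGroup X'] [Module k X'] [Module C X'] [IsScalarTower k C X']
  [AddCommGroup Y] [Module k Y] [Module C Y] [IsScalarTower k C Y]
  [AddCommGroup Z] [Module k Z] [Module C Z] [IsScalarTower k C Z]

theorem relDer_map_mul {S : Subalgebra k C} {D : C →ₗ[k] X →ₗ[k] Y} (hD : D ∈ relDer S X Y)
    (x y : C) (n : X) : D (x * y) n = x • D y n + D x (y • n) := hD.2 x y n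

theorem relDer_map_one {S : Subalgebra k C} {D : C →ₗ[k] X →ₗ[k] Y} (hD : D ∈ relDer S X Y) :
    D 1 = 0 := hD.1 1 S.one_mem

theorem mem_relDer_bot_iff {D : C →ₗ[k] X →ₗ[k] Y} :
    D ∈ relDer (⊥ : Subalgebra k C) X Y ↔
      ∀ (x y : C) (n : X), D (x * y) n = x • D y n + D x (y • n) := by
  refine ⟨fun h => h.2, fun h => ⟨fun r hr => ?_, h⟩⟩
  obtain ⟨c, rfl⟩ := Algebra.mem_bot.1 hr
  -- The Leibniz rule at 1 · 1 gives D(1) = D(1) + D(1), so vanishing on the scalars is automatic.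
  have h1 : D 1 = 0 := by
    ext n
    simpa using h 1 1 n
  rw [Algebra.algebraMap_eq_smul_one, map_smul, h1, smul_zero]

theorem relDer_le_bot (S : Subalgebra k C) : relDer S X Y ≤ relDer (⊥ : Subalgebra k C) X Y :=
  fun _ hD => mem_relDer_bot_iff.2 hD.2

/-- The zero set of a derivation is a subalgebra, so vanishing need only be tested on generators. -/
theorem mem_relDer_adjoin_iff {s : Set C} {D : C →ₗ[k] X →ₗ[k] Y} :
    D ∈ relDer (Algebra.adjoin k s) X Y ↔
      D ∈ relDer (⊥ : Subalgebra k C) X Y ∧ ∀ c ∈ s, D c = 0 := by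
  refine ⟨fun h => ⟨relDer_le_bot _ h, fun c hc => h.1 c (Algebra.subset_adjoin hc)⟩,
    fun ⟨h, hs⟩ => ⟨fun r hr => ?_, h.2⟩⟩
  induction hr using Algebra.adjoin_induction with
  | mem c hc => exact hs c hc
  | algebraMap c => exact h.1 _ (Subalgebra.algebraMap_mem _ c)
  | add x y _ _ hx hy => rw [map_add, hx, hy, add_zero]
  | mul x y _ _ hx hy =>
    ext n
    rw [relDer_map_mul h, hx, hy]
    simp

variable (k C X Y) in
/-- The space `Der_k(C, Hom_k(X, Y))` of all derivations. -/
abbrev fullDer : Submodule k (C →ₗ[k] X →ₗ[k] Y) := relDer (⊥ : Subalgebra k C) X Y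

/-- Postcomposition of a derivation with a module homomorphism. -/
theorem relDer_postcomp {S : Subalgebra k C} {D : C →ₗ[k] X →ₗ[k] Y} (hD : D ∈ relDer S X Y)
    (p : Y →ₗ[C] Z) :
    D.compr₂ (p.restrictScalars k) ∈ relDer S X Z :=
  ⟨fun r hr => by ext; simp [hD.1 r hr], fun x y n => by simp [hD.2]⟩

/-- Precomposition of a derivation with a module homomorphism. -/
theorem relDer_precomp {S : Subalgebra k C} {D : C →ₗ[k] X →ₗ[k] Y} (hD : D ∈ relDer S X Y)
    (p : X' →ₗ[C] X) :
    D.compl₂ (p.restrictScalars k) ∈ relDer S X' Y :=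
  ⟨fun r hr => by ext; simp [hD.1 r hr], fun x y n => by simp [hD.2]⟩

variable (k C X Y) in
/-- The inner derivation `c ↦ c φ - φ c` attached to a linear map `φ`. -/
def innerDer : (X →ₗ[k] Y) →ₗ[k] fullDer k C X Y :=
  LinearMap.codRestrict _
    { toFun φ := LinearMap.mk₂ k (fun c x => c • φ x - φ (c • x))
        (fun c c' x => by simp only [add_smul, map_add]; abel)
        (fun r c x => by simp only [smul_assoc, map_smul, smul_sub])
        (fun c x x' => by simp only [smul_add, map_add]; abel)
        (fun r c x => by simp only [smul_comm c r, map_smul, smul_sub])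
      map_add' φ ψ := by
        ext c x
        simp only [LinearMap.mk₂_apply, LinearMap.add_apply, smul_add]
        abel
      map_smul' r φ := by
        ext c x
        simp [smul_sub, smul_comm c r] }
    (fun φ => mem_relDer_bot_iff.2 fun x y n => by
      simp [mul_smul, smul_sub])

@[simp] theorem innerDer_apply (φ : X →ₗ[k] Y) (c : C) (x : X) :
    (innerDer k C X Y φ).1 c x = c • φ x - φ (c • x) := rfl

variable (k C X Y) in
/-- The kernel of `φ ↦ (c ↦ c φ - φ c)` consists of the module homomorphisms. -/
def kerInnerDerEquiv : LinearMap.ker (innerDer k C X Y) ≃ₗ[k] (X →ₗ[C] Y) where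
  toFun φ :=
    { toFun := φ.1
      map_add' := φ.1.map_add
      map_smul' c x := by
        have h := LinearMap.congr_fun (LinearMap.congr_fun (congrArg Subtype.val
          (LinearMap.mem_ker.1 φ.2)) c) x
        exact (sub_eq_zero.1 h).symm }
  invFun ψ := ⟨ψ.restrictScalars k, by
    rw [LinearMap.mem_ker]
    ext c x
    simp⟩
  left_inv _ := rfl
  right_inv _ := rfl
  map_add' _ _ := rfl
  map_smul' _ _ := rfl

variable (k C X) in
/-- The action map `C ⊗ X → X`. -/
def actionMap : C ⊗[k] X →ₗ[C] X :=
  AlgebraTensorModule.lift ((LinearMap.toSpanSingleton C (X →ₗ[k] X) LinearMap.id))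

@[simp] theorem actionMap_tmul (c : C) (x : X) : actionMap k C X (c ⊗ₜ x) = c • x := by
  simp [actionMap]

theorem actionMap_surjective : Function.Surjective (actionMap k C X) :=
  fun x => ⟨1 ⊗ₜ x, by simp⟩

variable (k C X) in
/-- The kernel of the action map `C ⊗ X → X`. -/
abbrev actionKer : Submodule C (C ⊗[k] X) := LinearMap.ker (actionMap k C X)

variable (k C X) in
/-- The linear projection `c ⊗ x ↦ c ⊗ x - 1 ⊗ c x` onto the kernel of the action map. -/
def actionKerProj : C ⊗[k] X →ₗ[k] actionKer k C X where
  toFun w := ⟨w - 1 ⊗ₜ actionMap k C X w, by simp⟩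
  map_add' w w' := by
    ext
    simp only [map_add, tmul_add, Submodule.coe_add]
    abel
  map_smul' r w := by
    apply Subtype.ext
    change r • w - 1 ⊗ₜ actionMap k C X (r • w) = r • (w - 1 ⊗ₜ actionMap k C X w)
    rw [LinearMap.map_smul_of_tower, tmul_smul, smul_sub]

theorem coe_actionKerProj (w : C ⊗[k] X) :
    (actionKerProj k C X w : C ⊗[k] X) = w - 1 ⊗ₜ actionMap k C X w := rfl

theorem actionKerProj_coe (w : actionKer k C X) : actionKerProj k C X w = w := by
  ext
  rw [coe_actionKerProj, LinearMap.mem_ker.1 w.2, tmul_zero, sub_zero]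

/-- This is the Leibniz rule for the universal derivation c ↦ (x ↦ c ⊗ x - 1 ⊗ c x) with values in
the kernel of the action map. -/
theorem actionKerProj_mul_tmul (c d : C) (x : X) :
    actionKerProj k C X ((c * d) ⊗ₜ x) =
      c • actionKerProj k C X (d ⊗ₜ x) + actionKerProj k C X (c ⊗ₜ (d • x)) := by
  ext
  simp only [coe_actionKerProj, Submodule.coe_add, Submodule.coe_smul, smul_sub, smul_tmul',
    actionMap_tmul, smul_eq_mul, mul_one, mul_smul]
  abel

/-- The Leibniz rule measures how far C ⊗ X → Y, c ⊗ x ↦ D(c) x, is from being C-linear; the defect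
disappears on the kernel of the action map. -/
theorem lift_smul_of_mem_fullDer {D : C →ₗ[k] X →ₗ[k] Y} (hD : D ∈ fullDer k C X Y) (c : C)
    (w : C ⊗[k] X) :
    TensorProduct.lift D (c • w) = c • TensorProduct.lift D w + D c (actionMap k C X w) := by
  induction w with
  | zero => simp
  | tmul d x => simp [smul_tmul', relDer_map_mul hD]
  | add w w' h h' => rw [smul_add, map_add, h, h', map_add, map_add, map_add, smul_add]; abel

variable (k C X Y) in
/-- The kernel of the action map `C ⊗ X → X` represents derivations. -/
def actionKerHomEquiv : fullDer k C X Y ≃ₗ[k] (actionKer k C X →ₗ[C] Y) where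
  toFun D :=
    { toFun w := TensorProduct.lift D.1 w
      map_add' w w' := by simp
      map_smul' c w := by
        simp [lift_smul_of_mem_fullDer D.2, LinearMap.mem_ker.1 w.2] }
  invFun φ := ⟨TensorProduct.curry (φ.restrictScalars k ∘ₗ actionKerProj k C X),
    mem_relDer_bot_iff.2 fun x y n => by simp [actionKerProj_mul_tmul]⟩
  left_inv D := by
    ext c x
    simp [coe_actionKerProj, relDer_map_one D.2]
  right_inv φ := by
    ext w
    have h := LinearMap.congr_fun ((TensorProduct.lift.equiv (.id k) C X Y).apply_symm_apply
      (φ.restrictScalars k ∘ₗ (actionKerProj k C X))) w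
    exact h.trans (congrArg φ (actionKerProj_coe w))
  map_add' D D' := by
    ext w
    exact LinearMap.congr_fun ((TensorProduct.lift.equiv (.id k) C X Y).map_add D.1 D'.1) w
  map_smul' r D := by
    ext w
    exact LinearMap.congr_fun ((TensorProduct.lift.equiv (.id k) C X Y).map_smul r D.1) w

/-- Naturality in the target, which turns lifting of derivations into the lifting property of the
kernel. -/
theorem actionKerHomEquiv_symm_postcomp (p : Y →ₗ[C] Z) (φ : actionKer k C X →ₗ[C] Y) :
    ((actionKerHomEquiv k C X Z).symm (p ∘ₗ φ)).1 =
      ((actionKerHomEquiv k C X Y).symm φ).1.compr₂ (p.restrictScalars k) := rfl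

variable (k C X Y) in
/-- `C ⊗ X` is the free module on the vector space `X`. -/
def tensorHomEquiv : (C ⊗[k] X →ₗ[C] Y) ≃ₗ[k] (X →ₗ[k] Y) :=
  (AlgebraTensorModule.lift.equiv k C k C X Y).symm.trans
    (LinearMap.ringLmapEquivSelf C k (X →ₗ[k] Y))

variable (k C X) in
/-- Derivations into `Hom_k(X, -)` lift along surjections. -/
def DerivationsLift : Prop :=
  ∀ (Y Z : Type u) [AddCommGroup Y] [Module k Y] [Module C Y] [IsScalarTower k C Y]
    [AddCommGroup Z] [Module k Z] [Module C Z] [IsScalarTower k C Z] (p : Y →ₗ[C] Z),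
    Function.Surjective p → ∀ D ∈ fullDer k C X Z, ∃ D' ∈ fullDer k C X Y,
      D'.compr₂ (p.restrictScalars k) = D

theorem DerivationsLift.projective (h : DerivationsLift k C X) :
    Module.Projective C (actionKer k C X) := by
  refine Module.Projective.of_lifting_property (R := C) fun {Y Z} _ _ _ _ p φ hp => ?_
  -- The lifting property is tested on bare C-modules; their `k`-structures are the ones induced by
  -- `C`.
  let _ : Module k Y := Module.compHom Y (algebraMap k C)
  let _ : Module k Z := Module.compHom Z (algebraMap k C)
  have : IsScalarTower k C Y := .of_algebraMap_smul fun _ _ => rfl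
  have : IsScalarTower k C Z := .of_algebraMap_smul fun _ _ => rfl
  obtain ⟨D, hD, hDp⟩ := h Y Z p hp _ ((actionKerHomEquiv k C X Z).symm φ).2
  refine ⟨actionKerHomEquiv k C X Y ⟨D, hD⟩, ?_⟩
  apply (actionKerHomEquiv k C X Z).symm.injective
  ext1
  rw [actionKerHomEquiv_symm_postcomp, LinearEquiv.symm_apply_apply, hDp]

section Dimensions

variable [Module.Finite k X] [Module.Finite k Y] [Module.Finite k (fullDer k C X Y)]

/-- The Euler form in terms of derivations. -/
theorem DerivationsLift.eulerForm (h : DerivationsLift k C X) :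
    HasEulerForm k C X Y ∧ homEulerForm k C X Y =
      Module.finrank k (X →ₗ[k] Y) - Module.finrank k (fullDer k C X Y) ∧
      homEulerForm k C X Y =
        Module.finrank k (X →ₗ[C] Y) - Module.finrank k (ExtMod C X Y 1) := by
  have := h.projective
  have : Module.Finite k (actionKer k C X →ₗ[C] Y) :=
    Module.Finite.equiv (actionKerHomEquiv k C X Y)
  have : Module.Finite k (C ⊗[k] X →ₗ[C] Y) :=
    Module.Finite.equiv (tensorHomEquiv k C X Y).symm
  have := eulerForm_of_resolution (k := k) (Y := Y) (i := (actionKer k C X).subtype)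
    (p := actionMap k C X) (Submodule.injective_subtype _)
    (actionMap k C X).exact_subtype_ker_map actionMap_surjective
  rwa [(tensorHomEquiv k C X Y).finrank_eq, ← (actionKerHomEquiv k C X Y).finrank_eq] at this

/-- A dimension count: the Euler form is both dim Hom_k - dim Der and dim Hom_C - dim Ext¹, and
Hom_C is the kernel of φ ↦ inner(φ), so its cokernel has the dimension of Ext¹. -/
theorem DerivationsLift.finrank_quotient_range_innerDer (h : DerivationsLift k C X) :
    Module.finrank k (fullDer k C X Y ⧸ LinearMap.range (innerDer k C X Y)) =
      Module.finrank k (ExtMod C X Y 1) := by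
  have e := h.eulerForm (Y := Y)
  have e₁ := (innerDer k C X Y).finrank_range_add_finrank_ker
  have e₂ := Submodule.finrank_quotient_add_finrank (LinearMap.range (innerDer k C X Y))
  have e₃ := (kerInnerDerEquiv k C X Y).finrank_eq
  have e₄ := e.2.1.symm.trans e.2.2
  omega

theorem DerivationsLift.subsingleton_ext_iff (h : DerivationsLift k C X) :
    Subsingleton (ExtMod C X Y 1) ↔ Function.Surjective (innerDer k C X Y) := by
  have : Module.Finite k (ExtMod C X Y 1) := (h.eulerForm (Y := Y)).1.1 1
  rw [← Module.finrank_zero_iff (R := k), ← h.finrank_quotient_range_innerDer,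
    Module.finrank_zero_iff, Submodule.Quotient.subsingleton_iff, LinearMap.range_eq_top]

end Dimensions

end DerivationResolution

/-! ### Derivations of path algebras -/

namespace PathAlgebra

noncomputable section PathDerivations

variable {k Q : Type u} [Field k] [Quiver.{u} Q] [Fintype Q]

theorem e_mul_e (i : Q) : e k i * e k i = e k i := ofPath_mul_comp _ _

theorem e_mul_e_of_ne {i j : Q} (h : j ≠ i) : e k i * e k j = 0 := ofPath_mul_of_ne _ _ h

theorem e_mul_ofPath {i j : Q} (p : Quiver.Path i j) : e k j * ofPath k p = ofPath k p :=
  ofPath_mul_comp _ _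

theorem ofPath_mul_e {i j : Q} (p : Quiver.Path i j) : ofPath k p * e k i = ofPath k p := by
  rw [e, ofPath_mul_comp, Quiver.Path.nil_comp]

theorem ofPath_cons {i j l : Q} (p : Quiver.Path i j) (a : j ⟶ l) :
    ofPath k (p.cons a) = ofPath k a.toPath * ofPath k p := by
  rw [ofPath_mul_comp, Quiver.Path.comp_toPath_eq_cons]

section

variable {X X' Y Z : Type u} [AddCommGroup X] [Module k X] [Module (PathAlgebra k Q) X]
  [IsScalarTower k (PathAlgebra k Q) X]
  [AddCommGroup X'] [Module k X'] [Module (PathAlgebra k Q) X']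
  [IsScalarTower k (PathAlgebra k Q) X']
  [AddCommGroup Y] [Module k Y] [Module (PathAlgebra k Q) Y] [IsScalarTower k (PathAlgebra k Q) Y]
  [AddCommGroup Z] [Module k Z] [Module (PathAlgebra k Q) Z] [IsScalarTower k (PathAlgebra k Q) Z]

theorem sum_e_smul (x : X) : ∑ i : Q, e k i • x = x := by
  rw [← Finset.sum_smul, ← one_def, one_smul]

variable (k Q X Y) in
/-- The derivations of `kQ` that vanish on the vertices. -/
abbrev vertexDer : Submodule k (PathAlgebra k Q →ₗ[k] X →ₗ[k] Y) :=
  relDer (vertexSubalgebra k Q) X Y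

theorem mem_vertexDer_iff {D : PathAlgebra k Q →ₗ[k] X →ₗ[k] Y} :
    D ∈ vertexDer k Q X Y ↔ D ∈ fullDer k (PathAlgebra k Q) X Y ∧ ∀ i, D (e k i) = 0 := by
  rw [vertexDer, vertexSubalgebra, mem_relDer_adjoin_iff, Set.forall_mem_range]

/-- Apply the Leibniz rule to p = e_j p, where D(e_j) = 0. With the next lemma, D(p) is determined
by a map e_i X → e_j Y. -/
theorem smul_vertexDer_ofPath {D : PathAlgebra k Q →ₗ[k] X →ₗ[k] Y} (hD : D ∈ vertexDer k Q X Y)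
    {i j : Q} (p : Quiver.Path i j) (x : X) :
    e k j • D (ofPath k p) x = D (ofPath k p) x := by
  conv_rhs => rw [← e_mul_ofPath p, relDer_map_mul hD, (mem_vertexDer_iff.1 hD).2]
  simp

theorem vertexDer_ofPath_smul {D : PathAlgebra k Q →ₗ[k] X →ₗ[k] Y} (hD : D ∈ vertexDer k Q X Y)
    {i j : Q} (p : Quiver.Path i j) (x : X) :
    D (ofPath k p) (e k i • x) = D (ofPath k p) x := by
  conv_rhs => rw [← ofPath_mul_e p, relDer_map_mul hD, (mem_vertexDer_iff.1 hD).2]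
  simp

/-- A derivation that vanishes on the vertices is determined by its values on the arrows. -/
theorem vertexDer_ext {D D' : PathAlgebra k Q →ₗ[k] X →ₗ[k] Y} (hD : D ∈ vertexDer k Q X Y)
    (hD' : D' ∈ vertexDer k Q X Y)
    (h : ∀ (i j : Q) (a : i ⟶ j), D (ofPath k a.toPath) = D' (ofPath k a.toPath)) : D = D' := by
  refine (basis k Q).ext fun ⟨i, j, p⟩ => ?_
  change D (ofPath k p) = D' (ofPath k p)
  induction p with
  | nil => exact ((mem_vertexDer_iff.1 hD).2 i).trans ((mem_vertexDer_iff.1 hD').2 i).symm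
  | cons p a ih =>
    ext x
    rw [ofPath_cons, relDer_map_mul hD, relDer_map_mul hD', ih, h]

/-- The value on a path of the derivation with prescribed values on the arrows. -/
def pathDer (φ : ∀ i j : Q, (i ⟶ j) → X →ₗ[k] Y) {i : Q} :
    ∀ {j : Q}, Quiver.Path i j → X →ₗ[k] Y
  | _, .nil => 0
  -- The Leibniz rule for `a` after `p`. The values `φ` are arbitrary linear maps, hence the
  -- projection by `e k j`; no projection is needed at the source because `p` already maps into the
  -- start vertex of `a`.
  | j, .cons p a => Algebra.lsmul k k Y (ofPath k a.toPath) ∘ₗ pathDer φ p +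
      Algebra.lsmul k k Y (e k j) ∘ₗ φ _ _ a ∘ₗ Algebra.lsmul k k X (ofPath k p)

theorem pathDer_cons (φ : ∀ i j : Q, (i ⟶ j) → X →ₗ[k] Y) {i j l : Q} (p : Quiver.Path i j)
    (a : j ⟶ l) (x : X) : pathDer φ (p.cons a) x =
      ofPath k a.toPath • pathDer φ p x + e k l • φ j l a (ofPath k p • x) := rfl

theorem smul_pathDer (φ : ∀ i j : Q, (i ⟶ j) → X →ₗ[k] Y) {i j : Q} (p : Quiver.Path i j)
    (x : X) : e k j • pathDer φ p x = pathDer φ p x := by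
  cases p with
  | nil => simp [pathDer]
  | cons p a => rw [pathDer_cons, smul_add, smul_smul, smul_smul, e_mul_ofPath, e_mul_e]

theorem pathDer_smul (φ : ∀ i j : Q, (i ⟶ j) → X →ₗ[k] Y) {i j : Q} (p : Quiver.Path i j)
    (x : X) : pathDer φ p (e k i • x) = pathDer φ p x := by
  induction p with
  | nil => simp [pathDer]
  | cons p a ih => rw [pathDer_cons, pathDer_cons, ih, smul_smul, ofPath_mul_e]

/-- The recursion peels off the last arrow, so induction on the later path gives the Leibniz rule;
the trivial path is where `smul_pathDer` is needed. -/
theorem pathDer_comp (φ : ∀ i j : Q, (i ⟶ j) → X →ₗ[k] Y) {i j l : Q} (q : Quiver.Path i j)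
    (p : Quiver.Path j l) (x : X) :
    pathDer φ (q.comp p) x = ofPath k p • pathDer φ q x + pathDer φ p (ofPath k q • x) := by
  induction p with
  | nil => exact (smul_pathDer φ q x).symm.trans (add_zero _).symm
  | cons p a ih =>
    rw [Quiver.Path.comp_cons, pathDer_cons, pathDer_cons, ih, ofPath_cons, smul_add, mul_smul,
      ← ofPath_mul_comp p q, mul_smul, add_assoc]

/-- The derivation that vanishes on the vertices and has prescribed values on the arrows. -/
def derOfArrows (φ : ∀ i j : Q, (i ⟶ j) → X →ₗ[k] Y) : PathAlgebra k Q →ₗ[k] X →ₗ[k] Y :=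
  (basis k Q).constr k fun p => pathDer φ p.2.2

theorem derOfArrows_ofPath (φ : ∀ i j : Q, (i ⟶ j) → X →ₗ[k] Y) {i j : Q} (p : Quiver.Path i j) :
    derOfArrows φ (ofPath k p) = pathDer φ p := by
  simp [derOfArrows, ofPath]

theorem derOfArrows_arrow (φ : ∀ i j : Q, (i ⟶ j) → X →ₗ[k] Y) {i j : Q} (a : i ⟶ j) (x : X) :
    derOfArrows φ (ofPath k a.toPath) x = e k j • φ i j a (e k i • x) := by
  rw [derOfArrows_ofPath, Quiver.Hom.toPath, pathDer_cons]
  simp [pathDer, e]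

theorem derOfArrows_mem (φ : ∀ i j : Q, (i ⟶ j) → X →ₗ[k] Y) :
    derOfArrows φ ∈ vertexDer k Q X Y := by
  refine mem_vertexDer_iff.2 ⟨mem_relDer_bot_iff.2 fun x y n => ?_, fun i => ?_⟩
  · induction x using induction with
    | h0 => simp
    | hadd x x' h h' => simp only [add_mul, map_add, LinearMap.add_apply, h, h', add_smul]; abel
    | hs c i j p =>
      rw [smul_mul_assoc, (derOfArrows φ).map_smul, (derOfArrows φ).map_smul,
        LinearMap.smul_apply, LinearMap.smul_apply, smul_assoc, ← smul_add]
      congr 1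
      induction y using induction with
      | h0 => simp
      | hadd y y' h h' =>
        simp only [mul_add, map_add, LinearMap.add_apply, h, h', add_smul, smul_add]; abel
      | hs d i' j' q =>
        rw [mul_smul_comm, (derOfArrows φ).map_smul, (derOfArrows φ).map_smul,
          LinearMap.smul_apply, LinearMap.smul_apply, smul_comm _ d, smul_assoc,
          (derOfArrows φ (ofPath k p)).map_smul, ← smul_add]
        congr 1
        simp only [derOfArrows_ofPath]
        by_cases h : j' = i
        · subst h
          rw [ofPath_mul_comp, derOfArrows_ofPath, pathDer_comp]
        -- For paths that do not compose, inserting the end idempotent of `q` and the start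
        -- idempotent of `p` kills both terms of the Leibniz rule.
        · rw [ofPath_mul_of_ne _ _ h, ← smul_pathDer, ← pathDer_smul φ p, smul_smul, smul_smul]
          rw [e, e, ofPath_mul_of_ne _ _ h, ofPath_mul_of_ne _ _ h]
          simp
  · exact derOfArrows_ofPath φ _

/-- The linear map that averages a derivation over the vertices. -/
def averagedMap (D : PathAlgebra k Q →ₗ[k] X →ₗ[k] Y) : X →ₗ[k] Y :=
  ∑ i : Q, D (e k i) ∘ₗ Algebra.lsmul k k X (e k i)

/-- Every derivation is the sum of an inner derivation and one that vanishes on the vertices. -/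
theorem add_innerDer_averagedMap_mem {D : PathAlgebra k Q →ₗ[k] X →ₗ[k] Y}
    (hD : D ∈ fullDer k (PathAlgebra k Q) X Y) :
    D + (innerDer k (PathAlgebra k Q) X Y (averagedMap D)).1 ∈ vertexDer k Q X Y := by
  refine mem_vertexDer_iff.2 ⟨add_mem hD (innerDer k (PathAlgebra k Q) X Y _).2, fun i => ?_⟩
  ext x
  have h₁ : averagedMap D (e k i • x) = D (e k i) (e k i • x) := by
    rw [averagedMap, LinearMap.sum_apply, Finset.sum_eq_single i]
    · simp [smul_smul, e_mul_e]
    · intro j _ hj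
      simp [smul_smul, e_mul_e_of_ne hj.symm]
    · simp
  have h₂ : e k i • averagedMap D x = D (e k i) (e k i • x) - D (e k i) x := by
    -- The Leibniz rule for e_i e_j; summing over `j`, only j = i survives in the first term, and
    -- the second adds up to D(e_i) x.
    have h : ∀ j : Q, e k i • D (e k j) (e k j • x) =
        D (e k i * e k j) (e k j • x) - D (e k i) (e k j • x) := fun j => by
      rw [relDer_map_mul hD, smul_smul, e_mul_e, add_sub_cancel_right]
    simp only [averagedMap, LinearMap.sum_apply, Finset.smul_sum, LinearMap.comp_apply,
      Algebra.lsmul_coe, h]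
    rw [Finset.sum_sub_distrib, ← map_sum, sum_e_smul, Finset.sum_eq_single i]
    · rw [e_mul_e]
    · intro j _ hj
      simp [e_mul_e_of_ne hj]
    · simp
  simp only [LinearMap.add_apply, innerDer_apply, h₁, h₂, LinearMap.zero_apply]
  abel

theorem exists_vertexDer_add_innerDer {D : PathAlgebra k Q →ₗ[k] X →ₗ[k] Y}
    (hD : D ∈ fullDer k (PathAlgebra k Q) X Y) :
    ∃ D₀ ∈ vertexDer k Q X Y, ∃ φ : X →ₗ[k] Y,
      D = D₀ + (innerDer k (PathAlgebra k Q) X Y φ).1 :=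
  ⟨_, add_innerDer_averagedMap_mem hD, -averagedMap D, by rw [map_neg]; simp⟩

/-- The inner part lifts with its linear map, and the part that vanishes on the vertices lifts
because its values on the arrows can be lifted one by one through a linear section of `p`. This is
what makes kQ hereditary. -/
theorem derivationsLift : DerivationsLift k (PathAlgebra k Q) X := by
  intro Y Z _ _ _ _ _ _ _ _ p hp D hD
  obtain ⟨s, hs⟩ := (p.restrictScalars k).exists_rightInverse_of_surjective
    (LinearMap.range_eq_top.2 hp)
  replace hs : ∀ z, p (s z) = z := LinearMap.congr_fun hs
  obtain ⟨D₀, hD₀, φ, rfl⟩ := exists_vertexDer_add_innerDer hD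
  refine ⟨derOfArrows (fun _ _ a => s ∘ₗ D₀ (ofPath k a.toPath)) +
    (innerDer k (PathAlgebra k Q) X Y (s ∘ₗ φ)).1,
    add_mem (relDer_le_bot _ (derOfArrows_mem _)) (Subtype.property _), ?_⟩
  have h : (derOfArrows (fun _ _ a => s ∘ₗ D₀ (ofPath k a.toPath))).compr₂
      (p.restrictScalars k) = D₀ := by
    refine vertexDer_ext (relDer_postcomp (derOfArrows_mem _) p) hD₀ fun i j a => ?_
    ext x
    simp [derOfArrows_arrow, hs, vertexDer_ofPath_smul hD₀, smul_vertexDer_ofPath hD₀]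
  ext c x
  have h' := LinearMap.congr_fun (LinearMap.congr_fun h c) x
  simp only [LinearMap.compr₂_apply, LinearMap.restrictScalars_apply] at h'
  simp [h', hs]

/-- Derivations extend along injective module homomorphisms. -/
theorem exists_fullDer_extension (ι : X →ₗ[PathAlgebra k Q] X') (hι : Function.Injective ι)
    {D : PathAlgebra k Q →ₗ[k] X →ₗ[k] Y} (hD : D ∈ fullDer k (PathAlgebra k Q) X Y) :
    ∃ D' ∈ fullDer k (PathAlgebra k Q) X' Y, D'.compl₂ (ι.restrictScalars k) = D := by
  -- Dual to lifting: a linear retraction `s` of `ι` extends the arrow values and the linear map of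
  -- the inner part.
  obtain ⟨s, hs⟩ := (ι.restrictScalars k).exists_leftInverse_of_injective
    (LinearMap.ker_eq_bot.2 hι)
  replace hs : ∀ x, s (ι x) = x := LinearMap.congr_fun hs
  obtain ⟨D₀, hD₀, φ, rfl⟩ := exists_vertexDer_add_innerDer hD
  refine ⟨derOfArrows (fun _ _ a => D₀ (ofPath k a.toPath) ∘ₗ s) +
    (innerDer k (PathAlgebra k Q) X' Y (φ ∘ₗ s)).1,
    add_mem (relDer_le_bot _ (derOfArrows_mem _)) (Subtype.property _), ?_⟩
  have h : (derOfArrows (fun _ _ a => D₀ (ofPath k a.toPath) ∘ₗ s)).compl₂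
      (ι.restrictScalars k) = D₀ := by
    refine vertexDer_ext (relDer_precomp (derOfArrows_mem _) ι) hD₀ fun i j a => ?_
    ext x
    simp only [LinearMap.compl₂_apply, LinearMap.restrictScalars_apply, derOfArrows_arrow,
      LinearMap.comp_apply, ← map_smul, hs]
    rw [vertexDer_ofPath_smul hD₀, smul_vertexDer_ofPath hD₀]
  ext c x
  have h' := LinearMap.congr_fun (LinearMap.congr_fun h c) x
  simp only [LinearMap.compl₂_apply, LinearMap.restrictScalars_apply] at h'
  simp only [LinearMap.compl₂_apply, LinearMap.add_apply, LinearMap.restrictScalars_apply,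
    innerDer_apply, LinearMap.comp_apply, ← ι.map_smul, hs, h']

variable (k) in
/-- The subspace `e i • X` of a module. -/
abbrev vertexSpace (X : Type u) [AddCommGroup X] [Module k X] [Module (PathAlgebra k Q) X]
    [IsScalarTower k (PathAlgebra k Q) X] (i : Q) : Submodule k X :=
  LinearMap.range (Algebra.lsmul k k X (e k i))

theorem e_smul_mem_vertexSpace (i : Q) (x : X) : e k i • x ∈ vertexSpace k X i := ⟨x, rfl⟩

theorem e_smul_of_mem_vertexSpace {i : Q} {x : X} (hx : x ∈ vertexSpace k X i) :
    e k i • x = x := by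
  obtain ⟨y, rfl⟩ := hx
  rw [Algebra.lsmul_coe, smul_smul, e_mul_e]

theorem e_smul_of_mem_vertexSpace_of_ne {i j : Q} (h : i ≠ j) {x : X}
    (hx : x ∈ vertexSpace k X i) : e k j • x = 0 := by
  obtain ⟨y, rfl⟩ := hx
  rw [Algebra.lsmul_coe, smul_smul, e_mul_e_of_ne h, zero_smul]

variable (k X) in
/-- The projection `x ↦ e i • x`. -/
abbrev vertexProj (i : Q) : X →ₗ[k] vertexSpace k X i :=
  (Algebra.lsmul k k X (e k i)).rangeRestrict

variable (k Q X Y) in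
/-- The values of a derivation on the arrows. -/
def arrowValues : vertexDer k Q X Y →ₗ[k]
    ((a : Σ i j : Q, i ⟶ j) → vertexSpace k X a.1 →ₗ[k] vertexSpace k Y a.2.1) where
  toFun D a := vertexProj k Y a.2.1 ∘ₗ D.1 (ofPath k a.2.2.toPath) ∘ₗ (vertexSpace k X a.1).subtype
  map_add' D D' := by ext; simp
  map_smul' c D := by ext; exact smul_comm _ _ _

theorem arrowValues_bijective : Function.Bijective (arrowValues k Q X Y) := by
  refine ⟨fun D D' h => Subtype.ext (vertexDer_ext D.2 D'.2 fun i j a => ?_), fun ψ => ?_⟩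
  · ext x
    have := congrArg Subtype.val (LinearMap.congr_fun (congrFun h ⟨i, j, a⟩)
      ⟨_, e_smul_mem_vertexSpace i x⟩)
    change e k j • D.1 (ofPath k a.toPath) (e k i • x) =
      e k j • D'.1 (ofPath k a.toPath) (e k i • x) at this
    rwa [smul_vertexDer_ofPath D.2, smul_vertexDer_ofPath D'.2, vertexDer_ofPath_smul D.2,
      vertexDer_ofPath_smul D'.2] at this
  · refine ⟨⟨_, derOfArrows_mem fun i j a => (vertexSpace k Y j).subtype ∘ₗ ψ ⟨i, j, a⟩ ∘ₗ
      vertexProj k X i⟩, ?_⟩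
    ext ⟨i, j, a⟩ x
    change e k j • derOfArrows _ (ofPath k a.toPath) (x : X) = (ψ ⟨i, j, a⟩ x : Y)
    rw [derOfArrows_arrow, smul_smul, e_mul_e, e_smul_of_mem_vertexSpace x.2]
    have h : vertexProj k X i x = x := Subtype.ext (e_smul_of_mem_vertexSpace x.2)
    simp only [LinearMap.comp_apply, h]
    exact e_smul_of_mem_vertexSpace (Subtype.property _)

variable (k Q X Y) in
/-- The linear maps that commute with the vertices. -/
def vertexHom : Submodule k (X →ₗ[k] Y) where
  carrier := {φ | ∀ (i : Q) (x : X), φ (e k i • x) = e k i • φ x}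
  zero_mem' := by simp
  add_mem' h h' i x := by simp [h i x, h' i x]
  smul_mem' c φ h i x := by simp [h i x, smul_comm c]

variable (k Q X Y) in
/-- The components of a linear map that commutes with the vertices. -/
def vertexHomComponents : vertexHom k Q X Y →ₗ[k]
    ((i : Q) → vertexSpace k X i →ₗ[k] vertexSpace k Y i) where
  toFun φ i := vertexProj k Y i ∘ₗ φ.1 ∘ₗ (vertexSpace k X i).subtype
  map_add' _ _ := by ext; simp
  map_smul' c _ := by ext; exact smul_comm _ _ _

theorem vertexHomComponents_bijective : Function.Bijective (vertexHomComponents k Q X Y) := by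
  refine ⟨fun φ φ' h => Subtype.ext ?_, fun ψ => ?_⟩
  · ext x
    rw [← sum_e_smul (k := k) (Q := Q) x, map_sum, map_sum]
    refine Finset.sum_congr rfl fun i _ => ?_
    have := congrArg Subtype.val (LinearMap.congr_fun (congrFun h i)
      ⟨_, e_smul_mem_vertexSpace i x⟩)
    change e k i • φ.1 (e k i • x) = e k i • φ'.1 (e k i • x) at this
    rwa [← φ.2, ← φ'.2, smul_smul, e_mul_e] at this
  · let φ : X →ₗ[k] Y := ∑ i, (vertexSpace k Y i).subtype ∘ₗ ψ i ∘ₗ vertexProj k X i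
    have hφ : ∀ i x, x ∈ vertexSpace k X i → φ x = ψ i (vertexProj k X i x) := fun i x hx => by
      simp only [φ, LinearMap.sum_apply]
      rw [Finset.sum_eq_single i]
      · rfl
      · intro j _ hj
        have h : vertexProj k X j x = 0 := Subtype.ext (e_smul_of_mem_vertexSpace_of_ne hj.symm hx)
        simp only [LinearMap.comp_apply, h, map_zero]
      · simp
    have hφ' : ∀ (i : Q) (x : X), φ (e k i • x) = e k i • φ x := fun i x => by
      have hsum : e k i • φ x = ∑ j : Q, e k i • φ (e k j • x) := by
        rw [← Finset.smul_sum, ← map_sum, sum_e_smul]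
      rw [hsum, Finset.sum_eq_single i]
      · rw [hφ i _ (e_smul_mem_vertexSpace i x), e_smul_of_mem_vertexSpace (Subtype.property _)]
      · intro j _ hj
        rw [hφ j _ (e_smul_mem_vertexSpace j x),
          e_smul_of_mem_vertexSpace_of_ne hj (Subtype.property _)]
      · simp
    refine ⟨⟨φ, hφ'⟩, ?_⟩
    ext i x
    change e k i • φ x = (ψ i x : Y)
    have h : vertexProj k X i x = x := Subtype.ext (e_smul_of_mem_vertexSpace x.2)
    rw [hφ i _ x.2, h, e_smul_of_mem_vertexSpace (Subtype.property _)]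

variable (k Q X Y) in
/-- The sum of a derivation that vanishes on the vertices and an inner derivation. -/
def vertexDerAddInner : vertexDer k Q X Y × (X →ₗ[k] Y) →ₗ[k] fullDer k (PathAlgebra k Q) X Y :=
  (Submodule.inclusion (relDer_le_bot _)).coprod (innerDer k (PathAlgebra k Q) X Y)

theorem vertexDerAddInner_surjective : Function.Surjective (vertexDerAddInner k Q X Y) := by
  rintro ⟨D, hD⟩
  obtain ⟨D₀, hD₀, φ, rfl⟩ := exists_vertexDer_add_innerDer hD
  exact ⟨(⟨D₀, hD₀⟩, φ), rfl⟩

variable (k Q X Y) in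
/-- The kernel of `vertexDerAddInner` consists of the linear maps that commute with the
vertices. -/
def kerVertexDerAddInnerEquiv :
    LinearMap.ker (vertexDerAddInner k Q X Y) ≃ₗ[k] vertexHom k Q X Y :=
  have key : ∀ w ∈ LinearMap.ker (vertexDerAddInner k Q X Y),
      w.1.1 + (innerDer k (PathAlgebra k Q) X Y w.2).1 = 0 := fun w hw =>
    congrArg Subtype.val (LinearMap.mem_ker.1 hw)
  { toFun w := ⟨w.1.2, fun i x => by
      have h := LinearMap.congr_fun (LinearMap.congr_fun (key _ w.2) (e k i)) x
      rw [LinearMap.add_apply, (mem_vertexDer_iff.1 w.1.1.2).2 i, zero_add] at h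
      exact (sub_eq_zero.1 h).symm⟩
    -- An inner derivation vanishes on the vertices exactly when its linear map commutes with them;
    -- the overlap of the two summands is recorded by that map.
    invFun φ := ⟨(⟨-(innerDer k (PathAlgebra k Q) X Y φ.1).1, mem_vertexDer_iff.2
        ⟨neg_mem (Subtype.property _), fun i => by ext x; simp [φ.2 i x]⟩⟩, φ.1), by
      rw [LinearMap.mem_ker]
      exact Subtype.ext (neg_add_cancel _)⟩
    left_inv w := by
      refine Subtype.ext (Prod.ext (Subtype.ext ?_) rfl)
      exact (eq_neg_of_add_eq_zero_left (key _ w.2)).symm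
    right_inv φ := rfl
    map_add' _ _ := rfl
    map_smul' _ _ := rfl }

end

section Dimensions

variable [∀ i j : Q, Fintype (i ⟶ j)]
variable {X Y : Type u} [AddCommGroup X] [Module k X] [Module (PathAlgebra k Q) X]
  [IsScalarTower k (PathAlgebra k Q) X] [Module.Finite k X]
  [AddCommGroup Y] [Module k Y] [Module (PathAlgebra k Q) Y] [IsScalarTower k (PathAlgebra k Q) Y]
  [Module.Finite k Y]

instance finite_vertexDer : Module.Finite k (vertexDer k Q X Y) :=
  Module.Finite.equiv (LinearEquiv.ofBijective _ arrowValues_bijective).symm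

instance finite_fullDer : Module.Finite k (fullDer k (PathAlgebra k Q) X Y) :=
  Module.Finite.of_surjective _ vertexDerAddInner_surjective

theorem finrank_vertexDer : (Module.finrank k (vertexDer k Q X Y) : ℤ) =
    ∑ i : Q, ∑ j : Q, ∑ _a : i ⟶ j, (dimVec k X i : ℤ) * dimVec k Y j := by
  rw [(LinearEquiv.ofBijective _ (arrowValues_bijective (k := k) (Q := Q) (X := X) (Y := Y))).finrank_eq,
    Module.finrank_pi_fintype, Fintype.sum_sigma]
  simp only [Fintype.sum_sigma, Module.finrank_linearMap]
  push_cast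
  rfl

theorem finrank_vertexHom : (Module.finrank k (vertexHom k Q X Y) : ℤ) =
    ∑ i : Q, (dimVec k X i : ℤ) * dimVec k Y i := by
  rw [(LinearEquiv.ofBijective _ (vertexHomComponents_bijective (k := k) (Q := Q) (X := X)
    (Y := Y))).finrank_eq, Module.finrank_pi_fintype]
  simp only [Module.finrank_linearMap]
  push_cast
  rfl

/-- Count dimensions in 0 → Hom_R(X, Y) → Der_R × Hom_k(X, Y) → Der_k → 0. -/
theorem finrank_fullDer_add_finrank_vertexHom :
    Module.finrank k (fullDer k (PathAlgebra k Q) X Y) + Module.finrank k (vertexHom k Q X Y) =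
      Module.finrank k (vertexDer k Q X Y) + Module.finrank k (X →ₗ[k] Y) := by
  have h := (vertexDerAddInner k Q X Y).finrank_range_add_finrank_ker
  rwa [LinearMap.range_eq_top.2 vertexDerAddInner_surjective, finrank_top,
    (kerVertexDerAddInnerEquiv k Q X Y).finrank_eq, Module.finrank_prod] at h

/-- The homological Euler form of a path algebra is the Euler form of the quiver. -/
theorem homEulerForm_eq : homEulerForm k (PathAlgebra k Q) X Y =
    quiverEulerForm Q (dimVec k X) (dimVec k Y) := by
  have h := finrank_fullDer_add_finrank_vertexHom (k := k) (Q := Q) (X := X) (Y := Y)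
  rw [(derivationsLift.eulerForm (Y := Y)).2.1, quiverEulerForm, ← finrank_vertexHom,
    ← finrank_vertexDer]
  omega

end Dimensions

end PathDerivations

end PathAlgebra

/-! ### Permanence of the condition that all derivations are inner -/

noncomputable section InnerDerivations

variable {k C : Type u} [Field k] [Ring C] [Algebra k C]
  {X X' Y Y' : Type u} [AddCommGroup X] [Module k X] [Module C X] [IsScalarTower k C X]
  [AddCommGroup X'] [Module k X'] [Module C X'] [IsScalarTower k C X']
  [AddCommGroup Y] [Module k Y] [Module C Y] [IsScalarTower k C Y]
  [AddCommGroup Y'] [Module k Y'] [Module C Y'] [IsScalarTower k C Y']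

theorem innerDer_surjective_iff : Function.Surjective (innerDer k C X Y) ↔
    ∀ D ∈ fullDer k C X Y, ∃ φ : X →ₗ[k] Y, ∀ (c : C) (x : X),
      D c x = c • φ x - φ (c • x) := by
  refine ⟨fun h D hD => ?_, fun h ⟨D, hD⟩ => ?_⟩
  · obtain ⟨φ, hφ⟩ := h ⟨D, hD⟩
    exact ⟨φ, fun c x => by rw [← innerDer_apply, hφ]⟩
  · obtain ⟨φ, hφ⟩ := h D hD
    exact ⟨φ, by ext c x; exact (hφ c x).symm⟩

theorem innerDer_surjective_of_sum_target {ι : Type*} [Fintype ι] (i : ι → Y' →ₗ[C] Y)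
    (p : ι → Y →ₗ[C] Y') (hip : ∀ y, ∑ j, i j (p j y) = y)
    (h : Function.Surjective (innerDer k C X Y')) : Function.Surjective (innerDer k C X Y) := by
  rw [innerDer_surjective_iff] at *
  intro D hD
  choose φ hφ using fun j => h _ (relDer_postcomp hD (p j))
  refine ⟨∑ j, (i j).restrictScalars k ∘ₗ φ j, fun c x => ?_⟩
  rw [← hip (D c x)]
  simp only [LinearMap.compr₂_apply, LinearMap.restrictScalars_apply] at hφ
  simp [hφ, Finset.smul_sum]

theorem innerDer_surjective_of_sum_source {ι : Type*} [Fintype ι] (i : ι → X' →ₗ[C] X)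
    (p : ι → X →ₗ[C] X') (hip : ∀ x, ∑ j, i j (p j x) = x)
    (h : Function.Surjective (innerDer k C X' Y)) : Function.Surjective (innerDer k C X Y) := by
  rw [innerDer_surjective_iff] at *
  intro D hD
  choose φ hφ using fun j => h _ (relDer_precomp hD (i j))
  refine ⟨∑ j, φ j ∘ₗ (p j).restrictScalars k, fun c x => ?_⟩
  conv_lhs => rw [← hip x, map_sum]
  simp only [LinearMap.compl₂_apply, LinearMap.restrictScalars_apply] at hφ
  simp [hφ, Finset.smul_sum]

/-- Right exactness of Ext¹(X, -) in terms of derivations: lift to Y', write the lift as inner, and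
project back. -/
theorem innerDer_surjective_of_surjective (hX : DerivationsLift k C X) (p : Y' →ₗ[C] Y)
    (hp : Function.Surjective p) (h : Function.Surjective (innerDer k C X Y')) :
    Function.Surjective (innerDer k C X Y) := by
  rw [innerDer_surjective_iff] at *
  intro D hD
  obtain ⟨D', hD', rfl⟩ := hX _ _ p hp D hD
  obtain ⟨φ, hφ⟩ := h D' hD'
  exact ⟨p.restrictScalars k ∘ₗ φ, fun c x => by simp [hφ]⟩

section Tensor

variable (k X) (W : Type u) [AddCommGroup W] [Module k W] {ι : Type*} (b : Module.Basis ι k W)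

/-- The inclusion `x ↦ x ⊗ b j`. -/
def tensorBasisIncl (j : ι) : X →ₗ[C] X ⊗[k] W := (AlgebraTensorModule.mk k C X W).flip (b j)

/-- The projection of `X ⊗ W` to the coefficient of a basis vector of `W`. -/
def tensorBasisProj (j : ι) : X ⊗[k] W →ₗ[C] X :=
  (AlgebraTensorModule.rid k C X).toLinearMap ∘ₗ
    AlgebraTensorModule.map LinearMap.id (b.coord j)

theorem sum_tensorBasisIncl_tensorBasisProj [Fintype ι] (x : X ⊗[k] W) :
    ∑ j, tensorBasisIncl (C := C) k X W b j (tensorBasisProj (C := C) k X W b j x) = x := by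
  induction x with
  | zero => simp
  | tmul x w =>
    conv_rhs => rw [← b.sum_repr w, tmul_sum]
    simp [tensorBasisIncl, tensorBasisProj]
  | add x y hx hy => simp only [map_add, Finset.sum_add_distrib, hx, hy]

end Tensor

end InnerDerivations

/-! ### Dimension vectors and Euler forms of X ⊗ W -/

namespace PathAlgebra

noncomputable section TensorDimension

variable {k Q : Type u} [Field k] [Quiver.{u} Q] [Fintype Q]
  {X Y W : Type u} [AddCommGroup X] [Module k X] [Module (PathAlgebra k Q) X]
  [IsScalarTower k (PathAlgebra k Q) X] [AddCommGroup Y] [Module k Y] [Module (PathAlgebra k Q) Y]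
  [IsScalarTower k (PathAlgebra k Q) Y] [AddCommGroup W] [Module k W]

theorem dimVec_tensor (i : Q) :
    dimVec k (X ⊗[k] W) i = Module.finrank k W * dimVec k X i := by
  -- The factorization of e_i through its image, tensored with `W`; by flatness over `k` the image
  -- on X ⊗ W is e_i X ⊗ W.
  have h : Algebra.lsmul k k (X ⊗[k] W) (e k i) =
      (vertexSpace k X i).subtype.rTensor W ∘ₗ (vertexProj k X i).rTensor W := by
    ext x w
    rfl
  rw [dimVec, h, LinearMap.range_comp_of_range_eq_top _ (LinearMap.range_eq_top.2
    (LinearMap.rTensor_surjective W (LinearMap.surjective_rangeRestrict _))),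
    LinearMap.finrank_range_of_inj
      (Module.Flat.rTensor_preserves_injective_linearMap _ (Submodule.injective_subtype _)),
    Module.finrank_tensorProduct, mul_comm]
  rfl

theorem _root_.quiverEulerForm_mul [∀ i j : Q, Fintype (i ⟶ j)] (c : ℕ) (d d' : Q → ℕ) :
    quiverEulerForm Q (fun i => c * d i) d' = c * quiverEulerForm Q d d' := by
  simp only [quiverEulerForm, mul_sub, Finset.mul_sum, Nat.cast_mul, mul_assoc]

theorem homEulerForm_tensor [∀ i j : Q, Fintype (i ⟶ j)] [Module.Finite k X] [Module.Finite k Y]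
    [Module.Finite k W] : homEulerForm k (PathAlgebra k Q) (X ⊗[k] W) Y =
      Module.finrank k W * homEulerForm k (PathAlgebra k Q) X Y := by
  rw [homEulerForm_eq, homEulerForm_eq, ← quiverEulerForm_mul]
  congr 1
  ext i
  exact dimVec_tensor i

end TensorDimension

end PathAlgebra

/-! ### Derivations of the one-point extension -/

namespace OnePointExt

section

variable {k A T M V : Type u} [Field k] [Ring A] [Algebra k A] [AddCommGroup T] [Module k T]
  [Module A T] [IsScalarTower k A T] [AddCommGroup M] [Module k M] [Module A M]
  [IsScalarTower k A M] [AddCommGroup V] [Module k V] {f : T ⊗[k] V →ₗ[A] M}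

@[simp] theorem Mod.fst_mk (m : M) (v : V) : (Mod.mk m v : Mod f).fst = m := rfl

@[simp] theorem Mod.snd_mk (m : M) (v : V) : (Mod.mk m v : Mod f).snd = v := rfl

end

noncomputable section Derivations

open PathAlgebra

variable {k Q : Type u} [Field k] [Quiver.{u} Q] [Fintype Q] {T M N V W : Type u}
  [AddCommGroup T] [Module k T] [Module (PathAlgebra k Q) T] [IsScalarTower k (PathAlgebra k Q) T]
  [AddCommGroup M] [Module k M] [Module (PathAlgebra k Q) M] [IsScalarTower k (PathAlgebra k Q) M]
  [AddCommGroup N] [Module k N] [Module (PathAlgebra k Q) N] [IsScalarTower k (PathAlgebra k Q) N]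
  [AddCommGroup V] [Module k V] [AddCommGroup W] [Module k W]
  (f : T ⊗[k] V →ₗ[PathAlgebra k Q] M) (g : T ⊗[k] W →ₗ[PathAlgebra k Q] N)

theorem mem_vertexSubalgebra_relDer_iff
    {D : OnePointExt k (PathAlgebra k Q) T →ₗ[k] Mod g →ₗ[k] Mod f} :
    D ∈ relDer (OnePointExt.vertexSubalgebra k Q T) (Mod g) (Mod f) ↔
      D ∈ fullDer k (OnePointExt k (PathAlgebra k Q) T) (Mod g) (Mod f) ∧
      (∀ i : Q, D ⟨PathAlgebra.e k i, 0, 0⟩ = 0) ∧ D ⟨0, 0, 1⟩ = 0 := by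
  rw [OnePointExt.vertexSubalgebra, mem_relDer_adjoin_iff]
  simp only [Set.mem_union, Set.mem_range, Set.mem_singleton_iff, or_imp, forall_and,
    forall_exists_index, forall_apply_eq_imp_iff, forall_eq]

variable (M) in
/-- The map whose kernel consists of the derivations of the one-point extension. -/
def matchingMap : vertexDer k Q N M × (T ⊗[k] W →ₗ[k] M) →ₗ[k]
    fullDer k (PathAlgebra k Q) (T ⊗[k] W) M :=
  LinearMap.coprod
    { toFun D := ⟨D.1.compl₂ (g.restrictScalars k), relDer_precomp (relDer_le_bot _ D.2) g⟩
      map_add' _ _ := rfl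
      map_smul' _ _ := rfl }
    (innerDer k (PathAlgebra k Q) (T ⊗[k] W) M)

variable {g} in
-- The condition on the right is the Leibniz rule for a product of an upper left entry `a` and an
-- upper right entry `t`.
theorem mem_ker_matchingMap_iff {w : vertexDer k Q N M × (T ⊗[k] W →ₗ[k] M)} :
    w ∈ LinearMap.ker (matchingMap M g) ↔ ∀ (a : PathAlgebra k Q) (x : T ⊗[k] W),
      w.2 (a • x) = a • w.2 x + w.1.1 a (g x) := by
  have h : ∀ (a : PathAlgebra k Q) (x : T ⊗[k] W), (matchingMap M g w).1 a x =
      w.1.1 a (g x) + (a • w.2 x - w.2 (a • x)) := fun a x => rfl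
  rw [LinearMap.mem_ker]
  refine ⟨fun hw a x => ?_, fun hw => ?_⟩
  · have := h a x
    rw [hw] at this
    change 0 = _ at this
    rw [← sub_eq_zero, ← neg_eq_zero, this]
    abel
  · refine Subtype.ext (LinearMap.ext fun a => LinearMap.ext fun x => ?_)
    rw [h, hw]
    change _ = (0 : M)
    abel

/-- The derivation of the one-point extension with the given components. -/
def derOfComponents : LinearMap.ker (matchingMap M g) →ₗ[k]
    relDer (OnePointExt.vertexSubalgebra k Q T) (Mod g) (Mod f) where
  toFun w := ⟨LinearMap.mk₂ k
      (fun b x => Mod.mk (w.1.1.1 b.a x.fst + w.1.2 (b.t ⊗ₜ x.snd)) 0)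
      (fun b b' x => by
        ext
        · simp only [add_a, add_t, map_add, add_tmul, LinearMap.add_apply]
          exact add_add_add_comm _ _ _ _
        · exact (add_zero _).symm)
      (fun c b x => by
        ext
        · simp only [smul_a, smul_t, map_smul, ← smul_tmul', LinearMap.smul_apply]
          exact (smul_add _ _ _).symm
        · exact (smul_zero _).symm)
      (fun b x x' => by
        ext
        · simp only [Mod.fst_add, Mod.snd_add, map_add, tmul_add]
          exact add_add_add_comm _ _ _ _
        · exact (add_zero _).symm)
      (fun c b x => by
        ext
        · simp only [Mod.fst_smul, Mod.snd_smul, map_smul, tmul_smul]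
          exact (smul_add _ _ _).symm
        · exact (smul_zero _).symm), by
    have hw := mem_ker_matchingMap_iff.1 w.2
    have hv := (mem_vertexDer_iff.1 w.1.1.2).2
    refine (mem_vertexSubalgebra_relDer_iff f g).2 ⟨mem_relDer_bot_iff.2 fun b b' x => ?_,
      fun i => ?_, ?_⟩
    · ext
      · change w.1.1.1 (b.a * b'.a) x.fst + w.1.2 ((b.a • b'.t + b'.c • b.t) ⊗ₜ x.snd) =
          (b.a • (w.1.1.1 b'.a x.fst + w.1.2 (b'.t ⊗ₜ x.snd)) + f (b.t ⊗ₜ (0 : V))) +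
          (w.1.1.1 b.a (b'.a • x.fst + g (b'.t ⊗ₜ x.snd)) + w.1.2 (b.t ⊗ₜ (b'.c • x.snd)))
        rw [relDer_map_mul w.1.1.2, add_tmul, map_add, ← smul_tmul', hw, smul_tmul, tmul_zero,
          map_zero, map_add, smul_add]
        abel
      · change (0 : V) = b.c • (0 : V) + 0
        simp
    · ext x
      · change w.1.1.1 (PathAlgebra.e k i) x.fst + w.1.2 ((0 : T) ⊗ₜ x.snd) = 0
        simp [hv]
      · rfl
    · ext x
      · change w.1.1.1 0 x.fst + w.1.2 ((0 : T) ⊗ₜ x.snd) = 0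
        simp
      · rfl⟩
  map_add' w w' := by
    ext b x
    · exact add_add_add_comm _ _ _ _
    · exact (add_zero _).symm
  map_smul' c w := by
    ext b x
    · exact (smul_add _ _ _).symm
    · exact (smul_zero _).symm

theorem fst_derOfComponents (w : LinearMap.ker (matchingMap M g))
    (b : OnePointExt k (PathAlgebra k Q) T) (x : Mod g) :
    ((derOfComponents f g w).1 b x).fst = w.1.1.1 b.a x.fst + w.1.2 (b.t ⊗ₜ x.snd) := rfl

theorem snd_derOfComponents (w : LinearMap.ker (matchingMap M g))
    (b : OnePointExt k (PathAlgebra k Q) T) (x : Mod g) :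
    ((derOfComponents f g w).1 b x).snd = 0 := rfl

theorem derOfComponents_injective : Function.Injective (derOfComponents f g) := by
  intro w w' h
  have key : ∀ (b : OnePointExt k (PathAlgebra k Q) T) (x : Mod g),
      w.1.1.1 b.a x.fst + w.1.2 (b.t ⊗ₜ x.snd) = w'.1.1.1 b.a x.fst + w'.1.2 (b.t ⊗ₜ x.snd) :=
    fun b x => by rw [← fst_derOfComponents f, h, fst_derOfComponents]
  refine Subtype.ext (Prod.ext (Subtype.ext ?_) ?_)
  · ext a n
    simpa using key ⟨a, 0, 0⟩ (Mod.mk n 0)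
  · ext t x
    simpa using key ⟨0, t, 0⟩ (Mod.mk 0 x)

variable (k Q T) in
/-- The inclusion of the upper left corner. -/
def inA : PathAlgebra k Q →ₗ[k] OnePointExt k (PathAlgebra k Q) T where
  toFun a := ⟨a, 0, 0⟩
  map_add' _ _ := by ext <;> simp
  map_smul' _ _ := by ext <;> simp

variable (k Q T) in
/-- The inclusion of the upper right corner. -/
def inT : T →ₗ[k] OnePointExt k (PathAlgebra k Q) T where
  toFun t := ⟨0, t, 0⟩
  map_add' _ _ := by ext <;> simp
  map_smul' _ _ := by ext <;> simp

theorem inA_mul (a a' : PathAlgebra k Q) : inA k Q T (a * a') = inA k Q T a * inA k Q T a' := by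
  ext <;> simp [inA]

theorem inA_mul_inT (a : PathAlgebra k Q) (t : T) :
    inA k Q T a * inT k Q T t = inT k Q T (a • t) := by
  ext <;> simp [inA, inT]

theorem eq_inA_add_inT_add (b : OnePointExt k (PathAlgebra k Q) T) :
    b = inA k Q T b.a + inT k Q T b.t + b.c • ⟨0, 0, 1⟩ := by
  ext <;> simp [inA, inT]

/-- Since `D` kills both corner idempotents, it respects the Peirce decomposition: it sends `a` to a
map N → M, `t` to a map W → M, and the scalar corner to zero. -/
theorem derOfComponents_surjective : Function.Surjective (derOfComponents f g) := by
  rintro ⟨D, hD⟩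
  obtain ⟨hD', hDe, hDc⟩ := (mem_vertexSubalgebra_relDer_iff f g).1 hD
  have he : D (inA k Q T 1) = 0 := by
    rw [one_def, map_sum, map_sum]
    exact Finset.sum_eq_zero fun i _ => hDe i
  -- With e the upper left idempotent, b = e b and D(e) = 0 give D(b) = e D(b), and e annihilates
  -- the second component.
  have hleft : ∀ b, inA k Q T 1 * b = b → ∀ x : Mod g, (D b x).snd = 0 := fun b hb x => by
    rw [← hb, relDer_map_mul hD', he, LinearMap.zero_apply, add_zero]
    simp [inA]
  have hA : ∀ a, inA k Q T 1 * inA k Q T a = inA k Q T a := fun a => by rw [← inA_mul, one_mul]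
  have hT : ∀ t, inA k Q T 1 * inT k Q T t = inT k Q T t := fun t => by
    rw [inA_mul_inT, one_smul]
  have hrA : ∀ a (x : Mod g), D (inA k Q T a) x = D (inA k Q T a) (Mod.mk x.fst 0) :=
    fun a x => by
      conv_lhs => rw [← mul_one a, inA_mul, relDer_map_mul hD', he]
      rw [LinearMap.zero_apply, smul_zero, zero_add]
      congr 1
      ext <;> simp [inA]
  have hrT : ∀ t (x : Mod g), D (inT k Q T t) x = D (inT k Q T t) (Mod.mk 0 x.snd) :=
    fun t x => by
      have h : inT k Q T t * ⟨0, 0, 1⟩ = inT k Q T t := by ext <;> simp [inT]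
      conv_lhs => rw [← h, relDer_map_mul hD', hDc]
      rw [LinearMap.zero_apply, smul_zero, zero_add]
      congr 1
      ext <;> simp
  let fstL : Mod f →ₗ[k] M := LinearMap.fst k M V
  let DA : PathAlgebra k Q →ₗ[k] N →ₗ[k] M :=
    ((D ∘ₗ inA k Q T).compl₂ (LinearMap.inl k N W)).compr₂ fstL
  let h : T ⊗[k] W →ₗ[k] M :=
    TensorProduct.lift (((D ∘ₗ inT k Q T).compl₂ (LinearMap.inr k N W)).compr₂ fstL)
  have hDA : ∀ a n, DA a n = (D (inA k Q T a) (Mod.mk n 0)).fst := fun a n => rfl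
  have hh : ∀ t w, h (t ⊗ₜ w) = (D (inT k Q T t) (Mod.mk 0 w)).fst := fun t w => rfl
  have hDAmem : DA ∈ vertexDer k Q N M := by
    refine mem_vertexDer_iff.2 ⟨mem_relDer_bot_iff.2 fun a a' n => ?_, fun i => ?_⟩
    · rw [hDA, inA_mul, relDer_map_mul hD', Mod.fst_add, Mod.fst_act, hleft _ (hA a'),
        hrA a (inA k Q T a' • _), hDA, hDA]
      simp [inA]
    · ext n
      rw [hDA]
      exact congrArg Mod.fst (LinearMap.congr_fun (hDe i) _)
  refine ⟨⟨(⟨DA, hDAmem⟩, h), mem_ker_matchingMap_iff.2 fun a x => ?_⟩, ?_⟩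
  · induction x with
    | zero => simp
    | add x y hx hy =>
      simp only at hx hy
      simp only [smul_add, map_add, hx, hy]
      abel
    | tmul t w =>
      change h (a • t ⊗ₜ w) = a • h (t ⊗ₜ w) + DA a (g (t ⊗ₜ w))
      rw [smul_tmul', hh, ← inA_mul_inT, relDer_map_mul hD', Mod.fst_add, Mod.fst_act,
        hleft _ (hT t), hrA, hh, hDA]
      simp [inA, inT]
  · refine Subtype.ext ?_
    ext b x
    · rw [fst_derOfComponents]
      change DA b.a x.fst + h (b.t ⊗ₜ x.snd) = (D b x).fst
      conv_rhs => rw [eq_inA_add_inT_add b]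
      simp only [map_add, map_smul, hDc, LinearMap.add_apply, smul_zero, add_zero, Mod.fst_add]
      rw [hDA, hh, ← hrA, ← hrT]
    · rw [snd_derOfComponents]
      conv_rhs => rw [eq_inA_add_inT_add b]
      simp only [map_add, map_smul, hDc, LinearMap.add_apply, smul_zero, add_zero, Mod.snd_add]
      rw [hleft _ (hA _), hleft _ (hT _), add_zero]

/-- The derivations of the one-point extension. -/
def derEquiv : LinearMap.ker (matchingMap M g) ≃ₗ[k]
    relDer (OnePointExt.vertexSubalgebra k Q T) (Mod g) (Mod f) :=
  LinearEquiv.ofBijective _ ⟨derOfComponents_injective f g, derOfComponents_surjective f g⟩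

variable (M) in
/-- The restriction of a derivation to the kernel of `g`, up to inner derivations. -/
def restrictKer : fullDer k (PathAlgebra k Q) (T ⊗[k] W) M →ₗ[k]
    fullDer k (PathAlgebra k Q) (LinearMap.ker g) M ⧸
      LinearMap.range (innerDer k (PathAlgebra k Q) (LinearMap.ker g) M) :=
  Submodule.mkQ _ ∘ₗ
    { toFun D := ⟨D.1.compl₂ ((LinearMap.ker g).subtype.restrictScalars k),
        relDer_precomp D.2 _⟩
      map_add' _ _ := rfl
      map_smul' _ _ := rfl }

theorem restrictKer_surjective : Function.Surjective (restrictKer M g) := by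
  refine (Submodule.mkQ_surjective _).comp fun ⟨D, hD⟩ => ?_
  obtain ⟨D', hD', h⟩ := exists_fullDer_extension (LinearMap.ker g).subtype
    (Submodule.injective_subtype _) hD
  exact ⟨⟨D', hD'⟩, Subtype.ext h⟩

/-- A derivation that vanishes on the kernel of `g` comes from a derivation on the codomain. -/
theorem exists_fullDer_of_vanish_ker {D : PathAlgebra k Q →ₗ[k] T ⊗[k] W →ₗ[k] M}
    (hD : D ∈ fullDer k (PathAlgebra k Q) (T ⊗[k] W) M)
    (h : ∀ a, ∀ x ∈ LinearMap.ker g, D a x = 0) :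
    ∃ D' ∈ fullDer k (PathAlgebra k Q) N M, D'.compl₂ (g.restrictScalars k) = D := by
  obtain ⟨s, hs⟩ := (g.restrictScalars k).rangeRestrict.exists_rightInverse_of_surjective
    (LinearMap.range_eq_top.2 (LinearMap.surjective_rangeRestrict _))
  let s' : LinearMap.range g →ₗ[k] T ⊗[k] W := s
  -- `s'` is only linear, but D(a) x depends only on g x, so D ∘ s' is a derivation on the image of
  -- `g`; it then extends to `N`.
  have hs' : ∀ x, g (s' x) = x := fun x => congrArg Subtype.val (LinearMap.congr_fun hs x)
  have key : ∀ a x y, g x = g y → D a x = D a y := fun a x y hxy => by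
    rw [← sub_eq_zero, ← map_sub]
    exact h _ _ (by simp [hxy])
  have hmem : D.compl₂ s' ∈ fullDer k (PathAlgebra k Q) (LinearMap.range g) M := by
    refine mem_relDer_bot_iff.2 fun a a' x => ?_
    simp only [LinearMap.compl₂_apply]
    rw [relDer_map_mul hD, key a (s' (a' • x)) (a' • s' x) (by simp [hs'])]
  obtain ⟨D', hD', h'⟩ := exists_fullDer_extension (LinearMap.range g).subtype
    (Submodule.injective_subtype _) hmem
  refine ⟨D', hD', ?_⟩
  refine LinearMap.ext fun a => LinearMap.ext fun x => ?_
  have := LinearMap.congr_fun (LinearMap.congr_fun h' a) ⟨g x, LinearMap.mem_range_self g x⟩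
  exact this.trans (key _ _ _ (hs' _))

/-- If `D` restricts on ker g to inner(φ), extend φ linearly to ψ. Then D - inner(ψ) vanishes on ker
g and comes from a derivation D₀ + inner(χ) on `N`, so D = D₀ ∘ g + inner(ψ + χ ∘ g). Conversely, D₀
∘ g vanishes on ker g. -/
theorem ker_restrictKer : LinearMap.ker (restrictKer M g) = LinearMap.range (matchingMap M g) := by
  ext ⟨D, hD⟩
  rw [LinearMap.mem_ker, restrictKer, LinearMap.comp_apply, Submodule.mkQ_apply,
    Submodule.Quotient.mk_eq_zero]
  constructor
  · rintro ⟨φ, hφ⟩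
    obtain ⟨ψ, hψ⟩ := LinearMap.exists_extend
      (p := (LinearMap.ker g).restrictScalars k) φ
    replace hψ : ∀ x : LinearMap.ker g, ψ x = φ x := LinearMap.congr_fun hψ
    have hD' := sub_mem hD (innerDer k (PathAlgebra k Q) (T ⊗[k] W) M ψ).2
    obtain ⟨D', hD', h⟩ := exists_fullDer_of_vanish_ker g hD' fun a x hx => by
      have h₁ := LinearMap.congr_fun (LinearMap.congr_fun (congrArg Subtype.val hφ) a) ⟨x, hx⟩
      have h₂ : D a x = a • φ ⟨x, hx⟩ - φ (a • ⟨x, hx⟩) := h₁.symm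
      rw [LinearMap.sub_apply, LinearMap.sub_apply, innerDer_apply, h₂, ← hψ, ← hψ]
      exact sub_self _
    obtain ⟨D₀, hD₀, χ, rfl⟩ := exists_vertexDer_add_innerDer hD'
    refine ⟨(⟨D₀, hD₀⟩, ψ + χ ∘ₗ g.restrictScalars k),
      Subtype.ext (LinearMap.ext fun a => LinearMap.ext fun x => ?_)⟩
    have := LinearMap.congr_fun (LinearMap.congr_fun h a) x
    simp only [LinearMap.compl₂_apply, LinearMap.sub_apply, LinearMap.add_apply, innerDer_apply,
      LinearMap.restrictScalars_apply] at this
    change D₀ a (g x) + (a • (ψ x + χ (g x)) - (ψ (a • x) + χ (g (a • x)))) = D a x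
    rw [g.map_smul, smul_add, ← sub_add_cancel (D a x) (a • ψ x - ψ (a • x)), ← this]
    abel
  · rintro ⟨⟨D₀, φ⟩, h⟩
    refine ⟨φ ∘ₗ (LinearMap.ker g).subtype.restrictScalars k,
      Subtype.ext (LinearMap.ext fun a => LinearMap.ext fun x => ?_)⟩
    have := LinearMap.congr_fun (LinearMap.congr_fun (congrArg Subtype.val h) a) x
    change D₀.1 a (g x) + (a • φ x - φ (a • x)) = D a x at this
    rw [LinearMap.mem_ker.1 x.2, map_zero, zero_add] at this
    exact this

section Finite

variable [∀ i j : Q, Fintype (i ⟶ j)] [Module.Finite k T] [Module.Finite k M]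
  [Module.Finite k N] [Module.Finite k W]

theorem finite_relDer : Module.Finite k
    (relDer (OnePointExt.vertexSubalgebra k Q T) (Mod g) (Mod f)) :=
  Module.Finite.equiv (derEquiv f g)

theorem finite_ext_ker :
    Module.Finite k (ExtMod (PathAlgebra k Q) (LinearMap.ker g) M 1) := by
  have : Module.Finite k (LinearMap.ker g) :=
    inferInstanceAs (Module.Finite k ((LinearMap.ker g).restrictScalars k))
  exact derivationsLift.eulerForm.1.1 1

/-- Rank and nullity for `matchingMap` and `restrictKer`, where dim Hom_k(T ⊗ W, M) - dim Der_k(A,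
Hom_k(T ⊗ W, M)) is ⟨T ⊗ W, M⟩. -/
theorem finrank_relDer : (Module.finrank k
    (relDer (OnePointExt.vertexSubalgebra k Q T) (Mod g) (Mod f)) : ℤ) =
      Module.finrank k (vertexDer k Q N M) +
      Module.finrank k W * homEulerForm k (PathAlgebra k Q) T M +
      Module.finrank k (ExtMod (PathAlgebra k Q) (LinearMap.ker g) M 1) := by
  have : Module.Finite k (LinearMap.ker g) :=
    inferInstanceAs (Module.Finite k ((LinearMap.ker g).restrictScalars k))
  have h₁ := (matchingMap M g).finrank_range_add_finrank_ker
  have h₂ := (restrictKer M g).finrank_range_add_finrank_ker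
  have h₅ := (LinearEquiv.ofTop _ (LinearMap.range_eq_top.2
    (restrictKer_surjective (M := M) g))).finrank_eq
  have h₆ := (derivationsLift (k := k) (Q := Q) (X := LinearMap.ker g)).finrank_quotient_range_innerDer (Y := M)
  rw [ker_restrictKer, h₅, h₆] at h₂
  rw [Module.finrank_prod, (derEquiv f g).finrank_eq] at h₁
  have h₃ := homEulerForm_tensor (k := k) (Q := Q) (X := T) (Y := M) (W := W)
  have h₄ := ((derivationsLift (k := k) (Q := Q) (X := T ⊗[k] W)).eulerForm (Y := M)).2.1
  rw [← h₃, h₄]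
  omega

theorem subsingleton_ext_ker [Module.Finite k V]
    (hT : Subsingleton (ExtMod (PathAlgebra k Q) T T 1)) (hf : Function.Surjective f) :
    Subsingleton (ExtMod (PathAlgebra k Q) (LinearMap.ker g) M 1) := by
  have : Module.Finite k (LinearMap.ker g) :=
    inferInstanceAs (Module.Finite k ((LinearMap.ker g).restrictScalars k))
  rw [derivationsLift.subsingleton_ext_iff] at hT ⊢
  have h₁ : Function.Surjective (innerDer k (PathAlgebra k Q) T (T ⊗[k] V)) :=
    innerDer_surjective_of_sum_target _ _
      (sum_tensorBasisIncl_tensorBasisProj k T V (Module.finBasis k V)) hT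
  have h₂ := innerDer_surjective_of_surjective derivationsLift f hf h₁
  have h₃ : Function.Surjective (innerDer k (PathAlgebra k Q) (T ⊗[k] W) M) :=
    innerDer_surjective_of_sum_source _ _
      (sum_tensorBasisIncl_tensorBasisProj k T W (Module.finBasis k W)) h₂
  rw [innerDer_surjective_iff] at h₃ ⊢
  intro D hD
  -- A derivation on ker g extends to T ⊗ W, is inner there, and so is inner on ker g.
  obtain ⟨D', hD', rfl⟩ := exists_fullDer_extension (LinearMap.ker g).subtype
    (Submodule.injective_subtype _) hD
  obtain ⟨φ, hφ⟩ := h₃ D' hD'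
  exact ⟨φ ∘ₗ (LinearMap.ker g).subtype.restrictScalars k, fun a x => hφ a x⟩

end Finite

end Derivations

end OnePointExt

/-! ### Projective modules and short exact sequences over the one-point extension -/

namespace OnePointExt

noncomputable section Resolution

variable {k A T M N V W : Type u} [Field k] [Ring A] [Algebra k A] [AddCommGroup T] [Module k T]
  [Module A T] [IsScalarTower k A T] [AddCommGroup M] [Module k M] [Module A M]
  [IsScalarTower k A M] [AddCommGroup N] [Module k N] [Module A N]
  [IsScalarTower k A N] [AddCommGroup V] [Module k V] [AddCommGroup W] [Module k W]
  {f : T ⊗[k] V →ₗ[A] M} {g : T ⊗[k] W →ₗ[A] N}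

/-- The homomorphism of modules over the one-point extension given by a compatible pair. -/
def Mod.map (φ : M →ₗ[A] N) (ψ : V →ₗ[k] W) (h : ∀ t v, φ (f (t ⊗ₜ v)) = g (t ⊗ₜ ψ v)) :
    Mod f →ₗ[OnePointExt k A T] Mod g where
  toFun x := Mod.mk (φ x.fst) (ψ x.snd)
  map_add' x y := by ext <;> simp
  map_smul' b x := by ext <;> simp [h]

@[simp] theorem Mod.fst_map (φ : M →ₗ[A] N) (ψ : V →ₗ[k] W)
    (h : ∀ t v, φ (f (t ⊗ₜ v)) = g (t ⊗ₜ ψ v)) (x : Mod f) :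
    (Mod.map φ ψ h x).fst = φ x.fst := rfl

@[simp] theorem Mod.snd_map (φ : M →ₗ[A] N) (ψ : V →ₗ[k] W)
    (h : ∀ t v, φ (f (t ⊗ₜ v)) = g (t ⊗ₜ ψ v)) (x : Mod f) :
    (Mod.map φ ψ h x).snd = ψ x.snd := rfl

variable (k A T M) in
/-- The module `(M, 0, 0)` over the one-point extension. -/
abbrev ZeroMod : Type u := Mod (0 : T ⊗[k] PUnit.{u + 1} →ₗ[A] M)

variable (k T) in
/-- The homomorphism `(M, 0, 0) → (N, 0, 0)` given by `M → N`. -/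
abbrev ZeroMod.map (φ : M →ₗ[A] N) :
    ZeroMod k A T M →ₗ[OnePointExt k A T] ZeroMod k A T N :=
  Mod.map φ LinearMap.id (by simp)

theorem ZeroMod.map_injective {φ : M →ₗ[A] N} (hφ : Function.Injective φ) :
    Function.Injective (ZeroMod.map k T φ) := fun _ _ h =>
  Mod.ext (hφ (congrArg Mod.fst h)) rfl

theorem ZeroMod.map_surjective {φ : M →ₗ[A] N} (hφ : Function.Surjective φ) :
    Function.Surjective (ZeroMod.map k T φ) := fun y => by
  obtain ⟨x, hx⟩ := hφ y.fst
  exact ⟨Mod.mk x 0, Mod.ext hx rfl⟩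

theorem ZeroMod.map_exact {L : Type u} [AddCommGroup L] [Module k L] [Module A L]
    [IsScalarTower k A L] {φ : L →ₗ[A] M} {ψ : M →ₗ[A] N} (h : Function.Exact φ ψ) :
    Function.Exact (ZeroMod.map k T φ) (ZeroMod.map k T ψ) := fun x => by
  constructor
  · intro hx
    obtain ⟨y, hy⟩ := (h x.fst).1 (congrArg Mod.fst hx)
    exact ⟨Mod.mk y 0, Mod.ext hy rfl⟩
  · rintro ⟨y, rfl⟩
    exact Mod.ext (h.apply_apply_eq_zero y.fst) rfl

variable (M g) in
/-- The module homomorphisms `(M, 0, 0) → (N, W, g)` are the module homomorphisms `M → N`. -/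
def zeroModHomEquiv : (ZeroMod k A T M →ₗ[OnePointExt k A T] Mod g) ≃ₗ[k] (M →ₗ[A] N) where
  toFun φ :=
    { toFun m := (φ (Mod.mk m 0)).fst
      map_add' m m' := by
        have h : (Mod.mk (m + m') 0 : ZeroMod k A T M) = Mod.mk m 0 + Mod.mk m' 0 :=
          Mod.ext rfl rfl
        rw [h, map_add, Mod.fst_add]
      map_smul' a m := by
        have h : (Mod.mk (a • m) 0 : ZeroMod k A T M) =
            (⟨a, 0, 0⟩ : OnePointExt k A T) • Mod.mk m 0 :=
          Mod.ext (by simp) rfl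
        rw [h, map_smul, Mod.fst_act]
        simp }
  invFun ψ := Mod.map ψ 0 (by simp)
  left_inv φ := by
    ext x
    · rfl
    · have h : x = (⟨1, 0, 0⟩ : OnePointExt k A T) • x := Mod.ext (by simp) rfl
      conv_rhs => rw [h, map_smul, Mod.snd_act, zero_smul]
      rfl
  right_inv _ := rfl
  map_add' _ _ := rfl
  map_smul' _ _ := rfl

/-- (A, 0, 0) is the left ideal of A[T] generated by the upper left idempotent, so a splitting of
`M` off a free A-module yields one of (M, 0, 0) off a free A[T]-module. -/
theorem zeroMod_projective [hM : Module.Projective A M] :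
    Module.Projective (OnePointExt k A T) (ZeroMod k A T M) := by
  obtain ⟨s, hs⟩ := Module.projective_def'.1 hM
  let inc : A →+ OnePointExt k A T :=
    { toFun a := ⟨a, 0, 0⟩
      map_zero' := rfl
      map_add' _ _ := by ext <;> simp }
  let i : ZeroMod k A T M →ₗ[OnePointExt k A T] (M →₀ OnePointExt k A T) :=
    { toFun x := (s x.fst).mapRange inc (map_zero inc)
      map_add' x y := by ext m : 1; simp
      map_smul' b x := by ext m <;> simp [inc] }
  let p : (M →₀ OnePointExt k A T) →ₗ[OnePointExt k A T] ZeroMod k A T M :=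
    Finsupp.linearCombination _ fun m => Mod.mk m 0
  refine Module.Projective.of_split i p (LinearMap.ext fun x => Mod.ext ?_ rfl)
  let fstHom : ZeroMod k A T M →+ M := ⟨⟨Mod.fst, rfl⟩, fun _ _ => rfl⟩
  change fstHom (Finsupp.linearCombination _ _ ((s x.fst).mapRange inc (map_zero inc))) = x.fst
  conv_rhs => rw [← LinearMap.id_apply (R := A) x.fst, ← hs]
  rw [LinearMap.comp_apply, Finsupp.linearCombination_apply, Finsupp.linearCombination_apply,
    Finsupp.sum_mapRange_index (by simp), Finsupp.sum, Finsupp.sum, map_sum]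
  refine Finset.sum_congr rfl fun m _ => ?_
  change (inc (s x.fst m) • (Mod.mk m 0 : ZeroMod k A T M)).fst = _
  simp [inc]

variable (k A T V) in
/-- The projective module `(T ⊗ V, V, id)` over the one-point extension. -/
abbrev IdMod : Type u := Mod (LinearMap.id : T ⊗[k] V →ₗ[A] T ⊗[k] V)

variable (V g) in
/-- The module homomorphisms `(T ⊗ V, V, id) → (N, W, g)` are the linear maps `V → W`. -/
def idModHomEquiv : (IdMod k A T V →ₗ[OnePointExt k A T] Mod g) ≃ₗ[k] (V →ₗ[k] W) where
  toFun φ :=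
    { toFun v := (φ (Mod.mk 0 v)).snd
      map_add' v v' := by
        have h : (Mod.mk 0 (v + v') : IdMod k A T V) = Mod.mk 0 v + Mod.mk 0 v' :=
          Mod.ext (by simp) rfl
        rw [h, map_add, Mod.snd_add]
      map_smul' c v := by
        have h : (Mod.mk 0 (c • v) : IdMod k A T V) =
            (⟨0, 0, c⟩ : OnePointExt k A T) • Mod.mk 0 v :=
          Mod.ext (by simp) rfl
        rw [h, map_smul, Mod.snd_act]
        rfl }
  invFun ψ := Mod.map (g ∘ₗ AlgebraTensorModule.lTensor A T ψ) ψ (by simp)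
  left_inv φ := by
    -- (0, v) is fixed by the lower right idempotent, so its image is too; acting on it by `t` then
    -- determines φ on T ⊗ V.
    have hfst : ∀ v, (φ (Mod.mk 0 v)).fst = 0 := fun v => by
      have h : (Mod.mk 0 v : IdMod k A T V) =
          (⟨0, 0, 1⟩ : OnePointExt k A T) • Mod.mk 0 v := Mod.ext (by simp) (by simp)
      rw [h, map_smul, Mod.fst_act]
      simp
    have hT : ∀ t v, φ (Mod.mk (t ⊗ₜ v) 0) = Mod.mk (g (t ⊗ₜ (φ (Mod.mk 0 v)).snd)) 0 :=
      fun t v => by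
        have h : (Mod.mk (t ⊗ₜ v) 0 : IdMod k A T V) =
            (⟨0, t, 0⟩ : OnePointExt k A T) • Mod.mk 0 v := Mod.ext (by simp) (by simp)
        rw [h, map_smul]
        ext <;> simp
    refine LinearMap.ext fun x => ?_
    have hx : x = Mod.mk x.fst 0 + Mod.mk 0 x.snd := by ext <;> simp
    rw [hx, map_add, map_add]
    congr 1
    · induction x.fst with
      | zero =>
        have h : (Mod.mk 0 0 : IdMod k A T V) = 0 := rfl
        rw [h, map_zero, map_zero]
      | add y z hy hz =>
        have h : (Mod.mk (y + z) 0 : IdMod k A T V) = Mod.mk y 0 + Mod.mk z 0 :=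
          Mod.ext rfl (by simp)
        rw [h, map_add, map_add, hy, hz]
      | tmul t v =>
        rw [hT]
        have h0 : (φ (Mod.mk 0 0)).snd = 0 := congrArg Mod.snd (map_zero φ)
        exact Mod.ext rfl h0
    · exact Mod.ext ((map_zero (g ∘ₗ AlgebraTensorModule.lTensor A T _)).trans
        (hfst x.snd).symm) rfl
  right_inv _ := rfl
  map_add' _ _ := rfl
  map_smul' _ _ := rfl

/-- The second column of A[T] is the left ideal of the lower right idempotent, and its tensor
product with `V` is (T ⊗ V, V, id): a direct summand of the free module A[T] ⊗ V. -/
instance idMod_projective : Module.Projective (OnePointExt k A T) (IdMod k A T V) := by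
  let inc : T →ₗ[k] OnePointExt k A T :=
    { toFun t := ⟨0, t, 0⟩
      map_add' _ _ := by ext <;> simp
      map_smul' _ _ := by ext <;> simp }
  have hinc : ∀ (b : OnePointExt k A T) (x : T ⊗[k] V),
      b • inc.rTensor V x = inc.rTensor V (b.a • x) := fun b x => by
    induction x with
    | zero => simp
    | add x y hx hy => simp only [map_add, smul_add, hx, hy]
    | tmul t v =>
      have h : b * inc t = inc (b.a • t) := by ext <;> simp [inc]
      rw [LinearMap.rTensor_tmul, smul_tmul', smul_tmul', LinearMap.rTensor_tmul, smul_eq_mul, h]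
  let i : IdMod k A T V →ₗ[OnePointExt k A T] OnePointExt k A T ⊗[k] V :=
    { toFun x := inc.rTensor V x.fst + (⟨0, 0, 1⟩ : OnePointExt k A T) ⊗ₜ x.snd
      map_add' x y := by simp only [Mod.fst_add, Mod.snd_add, map_add, tmul_add]; abel
      map_smul' b x := by
        have h : b * ⟨0, 0, 1⟩ = inc b.t + b.c • ⟨0, 0, 1⟩ := by ext <;> simp [inc]
        simp only [Mod.fst_act, Mod.snd_act, map_add, smul_add, hinc, RingHom.id_apply,
          LinearMap.id_apply, smul_tmul', smul_eq_mul, h, add_tmul, smul_tmul,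
          LinearMap.rTensor_tmul]
        abel }
  let incV : V →ₗ[k] IdMod k A T V := LinearMap.inr k (T ⊗[k] V) V
  let p : OnePointExt k A T ⊗[k] V →ₗ[OnePointExt k A T] IdMod k A T V :=
    AlgebraTensorModule.lift (LinearMap.toSpanSingleton _ _ incV)
  have hp : ∀ b v, p (b ⊗ₜ v) = b • incV v := fun b v => by simp [p]
  have hV : ∀ v, incV v = Mod.mk 0 v := fun v => rfl
  refine Module.Projective.of_split i p (LinearMap.ext fun x => ?_)
  have hT : ∀ y : T ⊗[k] V, p (inc.rTensor V y) = Mod.mk y 0 := fun y => by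
    induction y with
    | zero => rw [map_zero, map_zero]; rfl
    | add y z hy hz =>
      rw [map_add, map_add, hy, hz]
      ext <;> simp
    | tmul t v =>
      rw [LinearMap.rTensor_tmul, hp, hV]
      ext <;> simp [inc]
  change p (inc.rTensor V x.fst + (⟨0, 0, 1⟩ : OnePointExt k A T) ⊗ₜ x.snd) = x
  rw [map_add, hT, hp, hV]
  ext <;> simp

variable (f) in
/-- The inclusion `(T ⊗ V, 0) → (M, 0) × (T ⊗ V, V, id)`, `x ↦ (-f x, x)`. -/
def syzygyIncl : ZeroMod k A T (T ⊗[k] V) →ₗ[OnePointExt k A T] ZeroMod k A T M × IdMod k A T V :=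
  (ZeroMod.map k T (-f)).prod (Mod.map LinearMap.id 0 (by simp))

variable (f) in
/-- The surjection `(M, 0) × (T ⊗ V, V, id) → (M, V, f)`. -/
def syzygyProj : ZeroMod k A T M × IdMod k A T V →ₗ[OnePointExt k A T] Mod f :=
  (Mod.map LinearMap.id 0 (by simp)).coprod (Mod.map f LinearMap.id (by simp))

theorem syzygyIncl_injective : Function.Injective (syzygyIncl f) := fun _ _ h =>
  Mod.ext (congrArg (fun w => w.2.fst) h) rfl

theorem syzygyProj_surjective : Function.Surjective (syzygyProj f) := fun x =>
  ⟨(Mod.mk x.fst 0, Mod.mk 0 x.snd), by ext <;> simp [syzygyProj]⟩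

theorem syzygy_exact : Function.Exact (syzygyIncl f) (syzygyProj f) := by
  rintro ⟨x, y⟩
  constructor
  · intro h
    have h₁ : x.fst + f y.fst = 0 := congrArg Mod.fst h
    have h₂ : (0 : V) + y.snd = 0 := congrArg Mod.snd h
    rw [zero_add] at h₂
    refine ⟨Mod.mk y.fst 0, Prod.ext (Mod.ext ?_ rfl) (Mod.ext rfl h₂.symm)⟩
    exact (eq_neg_of_add_eq_zero_left h₁).symm
  · rintro ⟨z, hz⟩
    obtain ⟨rfl, rfl⟩ := Prod.mk.inj hz
    ext
    · exact neg_add_cancel (f z.fst)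
    · exact add_zero (0 : V)

end Resolution

/-! ### The homological Euler form of the one-point extension -/

noncomputable section EulerForm

open PathAlgebra

variable {k Q : Type u} [Field k] [Quiver.{u} Q] [Fintype Q] [∀ i j : Q, Fintype (i ⟶ j)]
  {T M N V W : Type u}
  [AddCommGroup T] [Module k T] [Module (PathAlgebra k Q) T] [IsScalarTower k (PathAlgebra k Q) T]
  [AddCommGroup M] [Module k M] [Module (PathAlgebra k Q) M] [IsScalarTower k (PathAlgebra k Q) M]
  [AddCommGroup N] [Module k N] [Module (PathAlgebra k Q) N] [IsScalarTower k (PathAlgebra k Q) N]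
  [AddCommGroup V] [Module k V] [AddCommGroup W] [Module k W]
  [Module.Finite k M] [Module.Finite k N]
  (f : T ⊗[k] V →ₗ[PathAlgebra k Q] M) (g : T ⊗[k] W →ₗ[PathAlgebra k Q] N)

variable (M) in
/-- The Euler form of `(M, 0, 0) × P` for a projective module `P`. -/
theorem eulerForm_zeroMod_prod (P : Type u) [AddCommGroup P]
    [Module (OnePointExt k (PathAlgebra k Q) T) P]
    [Module.Projective (OnePointExt k (PathAlgebra k Q) T) P]
    [Module.Finite k (P →ₗ[OnePointExt k (PathAlgebra k Q) T] Mod g)] :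
    HasEulerForm k (OnePointExt k (PathAlgebra k Q) T) (ZeroMod k (PathAlgebra k Q) T M × P)
      (Mod g) ∧
    homEulerForm k (OnePointExt k (PathAlgebra k Q) T) (ZeroMod k (PathAlgebra k Q) T M × P)
      (Mod g) = quiverEulerForm Q (dimVec k M) (dimVec k N) +
        Module.finrank k (P →ₗ[OnePointExt k (PathAlgebra k Q) T] Mod g) := by
  let A := PathAlgebra k Q
  have : Module.Projective A (actionKer k A M) := derivationsLift.projective
  have e₁ := (zeroModHomEquiv (actionKer k A M) g).trans (actionKerHomEquiv k A M N).symm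
  have e₂ := (LinearMap.coprodEquiv k (M := ZeroMod k A T (A ⊗[k] M)) (M₂ := P)
    (R := OnePointExt k A T) (M₃ := Mod g)).symm.trans
    (((zeroModHomEquiv (A ⊗[k] M) g).trans (tensorHomEquiv k A M N)).prodCongr (.refl k _))
  have := zeroMod_projective (k := k) (T := T) (A := A) (M := actionKer k A M)
  have := zeroMod_projective (k := k) (T := T) (A := A) (M := A ⊗[k] M)
  have := Module.Finite.equiv e₁.symm
  have := Module.Finite.equiv e₂.symm
  have hi := ZeroMod.map_injective (k := k) (T := T) (Submodule.injective_subtype (actionKer k A M))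
  have hex := ZeroMod.map_exact (k := k) (T := T) (actionMap k A M).exact_subtype_ker_map
  have hp := ZeroMod.map_surjective (k := k) (T := T) (actionMap_surjective (k := k) (C := A)
    (X := M))
  -- With K the kernel of A ⊗ M → M, the resolution is 0 → (K, 0, 0) → (A ⊗ M, 0, 0) × P → (M, 0, 0)
  -- × P → 0.
  have key := eulerForm_of_resolution (k := k) (Y := Mod g)
    (i := LinearMap.inl _ _ P ∘ₗ ZeroMod.map k T (actionKer k A M).subtype)
    (p := (ZeroMod.map k T (actionMap k A M)).prodMap (LinearMap.id (M := P)))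
    (LinearMap.inl_injective.comp hi)
    (by
      rintro ⟨x, y⟩
      constructor
      · intro h
        obtain ⟨z, rfl⟩ := (hex x).1 (congrArg Prod.fst h)
        exact ⟨z, Prod.ext rfl (congrArg Prod.snd h).symm⟩
      · rintro ⟨z, hz⟩
        obtain ⟨rfl, rfl⟩ := Prod.mk.inj hz
        exact Prod.ext (hex.apply_apply_eq_zero z) rfl)
    (hp.prodMap Function.surjective_id)
  refine ⟨key.1, ?_⟩
  have h := (derivationsLift (k := k) (Q := Q) (X := M)).eulerForm (Y := N)
  rw [key.2.1, e₁.finrank_eq, e₂.finrank_eq, Module.finrank_prod, ← homEulerForm_eq, h.2.1]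
  push_cast
  ring

variable (M) in
/-- The Euler form of `(M, 0, 0)`. -/
theorem eulerForm_zeroMod :
    HasEulerForm k (OnePointExt k (PathAlgebra k Q) T) (ZeroMod k (PathAlgebra k Q) T M)
      (Mod g) ∧
    homEulerForm k (OnePointExt k (PathAlgebra k Q) T) (ZeroMod k (PathAlgebra k Q) T M)
      (Mod g) = quiverEulerForm Q (dimVec k M) (dimVec k N) := by
  let A := PathAlgebra k Q
  have : Module.Projective A (actionKer k A M) := derivationsLift.projective
  have e₁ := (zeroModHomEquiv (actionKer k A M) g).trans (actionKerHomEquiv k A M N).symm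
  have e₂ := (zeroModHomEquiv (A ⊗[k] M) g).trans (tensorHomEquiv k A M N)
  have := zeroMod_projective (k := k) (T := T) (A := A) (M := actionKer k A M)
  have := zeroMod_projective (k := k) (T := T) (A := A) (M := A ⊗[k] M)
  have := Module.Finite.equiv e₁.symm
  have := Module.Finite.equiv e₂.symm
  have key := eulerForm_of_resolution (k := k) (Y := Mod g)
    (ZeroMod.map_injective (k := k) (T := T) (Submodule.injective_subtype (actionKer k A M)))
    (ZeroMod.map_exact (k := k) (T := T) (actionMap k A M).exact_subtype_ker_map)
    (ZeroMod.map_surjective (k := k) (T := T) (actionMap_surjective (k := k) (C := A)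
      (X := M)))
  refine ⟨key.1, ?_⟩
  have h := (derivationsLift (k := k) (Q := Q) (X := M)).eulerForm (Y := N)
  rw [key.2.1, e₁.finrank_eq, e₂.finrank_eq, ← homEulerForm_eq, h.2.1]

/-- The Euler form of the one-point extension. -/
theorem eulerForm_mod [Module.Finite k T] [Module.Finite k V] [Module.Finite k W] :
    HasEulerForm k (OnePointExt k (PathAlgebra k Q) T) (Mod f) (Mod g) ∧
    homEulerForm k (OnePointExt k (PathAlgebra k Q) T) (Mod f) (Mod g) =
      Module.finrank k V * Module.finrank k W -
      Module.finrank k V * quiverEulerForm Q (dimVec k T) (dimVec k N) +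
      quiverEulerForm Q (dimVec k M) (dimVec k N) := by
  have := Module.Finite.equiv (idModHomEquiv V g).symm
  have h₁ := eulerForm_zeroMod (T ⊗[k] V) g
  have h₂ := eulerForm_zeroMod_prod M g (IdMod k (PathAlgebra k Q) T V)
  have h₃ := eulerForm_of_shortExact (Mod g) (syzygyIncl_injective (f := f)) syzygy_exact
    syzygyProj_surjective h₁.1 h₂.1
  refine ⟨h₃.1, ?_⟩
  have h₄ : dimVec k (T ⊗[k] V) = fun i : Q => Module.finrank k V * dimVec k T i :=
    funext dimVec_tensor
  rw [h₃.2, h₁.2, h₂.2, h₄, quiverEulerForm_mul, (idModHomEquiv V g).finrank_eq,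
    Module.finrank_linearMap]
  push_cast
  ring

end EulerForm

end OnePointExt

end

theorem theorem3p7 {k : Type u} [Field k] [IsAlgClosed k]
    {Q : Type u} [Quiver.{u} Q] [Fintype Q] [∀ i j : Q, Fintype (i ⟶ j)]
    {T M N V W : Type u}
    [AddCommGroup T] [Module k T] [Module (PathAlgebra k Q) T]
    [IsScalarTower k (PathAlgebra k Q) T] [Module.Finite k T]
    [AddCommGroup M] [Module k M] [Module (PathAlgebra k Q) M]
    [IsScalarTower k (PathAlgebra k Q) M] [Module.Finite k M]
    [AddCommGroup N] [Module k N] [Module (PathAlgebra k Q) N]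
    [IsScalarTower k (PathAlgebra k Q) N] [Module.Finite k N]
    [AddCommGroup V] [Module k V] [Module.Finite k V]
    [AddCommGroup W] [Module k W] [Module.Finite k W]
    (f : T ⊗[k] V →ₗ[PathAlgebra k Q] M) (g : T ⊗[k] W →ₗ[PathAlgebra k Q] N) :
    -- the dimension of the space of derivations
    (Module.Finite k
        (relDer (OnePointExt.vertexSubalgebra k Q T) (OnePointExt.Mod g) (OnePointExt.Mod f)) ∧
      Module.Finite k (relDer (PathAlgebra.vertexSubalgebra k Q) N M) ∧
      HasEulerForm k (PathAlgebra k Q) T M ∧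
      Module.Finite k (ExtMod (PathAlgebra k Q) (LinearMap.ker g) M 1) ∧
      (Module.finrank k
        (relDer (OnePointExt.vertexSubalgebra k Q T) (OnePointExt.Mod g) (OnePointExt.Mod f)) : ℤ) =
        Module.finrank k (relDer (PathAlgebra.vertexSubalgebra k Q) N M) +
        Module.finrank k W * homEulerForm k (PathAlgebra k Q) T M +
        Module.finrank k (ExtMod (PathAlgebra k Q) (LinearMap.ker g) M 1)) ∧
    -- the case of full modules and a rigid module `T`
    (Subsingleton (ExtMod (PathAlgebra k Q) T T 1) →
      Function.Surjective f → Function.Surjective g →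
      Subsingleton (ExtMod (PathAlgebra k Q) (LinearMap.ker g) M 1) ∧
      (Module.finrank k
        (relDer (OnePointExt.vertexSubalgebra k Q T) (OnePointExt.Mod g) (OnePointExt.Mod f)) : ℤ) =
        Module.finrank k (relDer (PathAlgebra.vertexSubalgebra k Q) N M) +
        Module.finrank k W * homEulerForm k (PathAlgebra k Q) T M) ∧
    -- the homological Euler form of the one-point extension
    (HasEulerForm k (OnePointExt k (PathAlgebra k Q) T) (OnePointExt.Mod f) (OnePointExt.Mod g) ∧
      homEulerForm k (OnePointExt k (PathAlgebra k Q) T) (OnePointExt.Mod f) (OnePointExt.Mod g) =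
        Module.finrank k V * Module.finrank k W -
        Module.finrank k V *
          quiverEulerForm Q (PathAlgebra.dimVec k T) (PathAlgebra.dimVec k N) +
        quiverEulerForm Q (PathAlgebra.dimVec k M) (PathAlgebra.dimVec k N)) := by
  refine ⟨⟨OnePointExt.finite_relDer f g, PathAlgebra.finite_vertexDer,
    (PathAlgebra.derivationsLift.eulerForm).1,
    OnePointExt.finite_ext_ker g, OnePointExt.finrank_relDer f g⟩,
    fun hT hf _ => ?_, OnePointExt.eulerForm_mod f g⟩
  have h := OnePointExt.subsingleton_ext_ker f g hT hf
  refine ⟨h, ?_⟩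
  rw [OnePointExt.finrank_relDer f g, Module.finrank_zero_of_subsingleton (R := k)
    (M := ExtMod (PathAlgebra k Q) (LinearMap.ker g) M 1)]
  simp
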